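/- Let $\mathfrak{C}$ be a category with all finite limits, and let $\mathbf{Cat}(\mathfrak{C})$ be the category of internal categories $\mathcal{H} = (H_1 \rightrightarrows H_0)$ and internal functors $\Phi = (\Phi_0, \Phi_1)$ in $\mathfrak{C}$ (it has pullbacks, computed on objects and on arrows). An internal functor $\Phi\colon \mathcal{H} \to \mathcal{K}$ is \emph{fully faithful} if the square with horizontal maps $\Phi_1\colon H_1 \to K_1$ and $\Phi_0 \times \Phi_0\colon H_0 \times H_0 \to K_0 \times K_0$ and vertical maps $(s,t)$ (source and target) is a pullback. It is a \emph{discrete opfibration} if the square formed by $s\colon H_1 \to H_0$, $\Phi_1$, $\Phi_0$ and $s\colon K_1 \to K_0$ is a pullback. A morphism $f\colon X \to Y$ in a category with pullbacks is an \emph{effective descent morphism} if pullback along $f$, viewed as an internal functor from the internal category given by the kernel pair $X \times_Y X \rightrightarrows X$ to the categorically discrete internal category on $Y$, is an equivalence from the category of discrete opfibrations over (the discrete internal category on) $Y$ to the category of discrete opfibrations over the kernel pair of $f$ (morphisms being the internal functors over the base). \textbf{Lemma.} Let $\Phi\colon \mathcal{H} \to \mathcal{K}$ be an internal functor in $\mathfrak{C}$.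 If $\Phi$ is fully faithful and $\Phi_0$ is an effective descent morphism in $\mathfrak{C}$, then $\Phi$ is an effective descent morphism in $\mathbf{Cat}(\mathfrak{C})$, and $\Phi_1$ is an effective descent morphism in $\mathfrak{C}$. -/

import Mathlib

open CategoryTheory CategoryTheory.Limits

universe v u

section

attribute [local simp] pullback.lift_fst pullback.lift_snd pullback.lift_fst_assoc
  pullback.lift_snd_assoc

/-- An internal category in a category `C` with pullbacks. The composition `comp` takes its
arguments in diagrammatic order: it is defined on the pullback of `tgt` along `src`. -/
structure InternalCat (C : Type u) [Category.{v} C] [HasPullbacks C] where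
  /-- the object of objects -/
  obj : C
  /-- the object of arrows -/
  arr : C
  src : arr ⟶ obj
  tgt : arr ⟶ obj
  idt : obj ⟶ arr
  comp : pullback tgt src ⟶ arr
  idt_src : idt ≫ src = 𝟙 obj
  idt_tgt : idt ≫ tgt = 𝟙 obj
  comp_src : comp ≫ src = pullback.fst tgt src ≫ src
  comp_tgt : comp ≫ tgt = pullback.snd tgt src ≫ tgt
  idt_comp : pullback.lift (src ≫ idt) (𝟙 arr) (by simp [idt_tgt]) ≫ comp = 𝟙 arr
  comp_idt : pullback.lift (𝟙 arr) (tgt ≫ idt) (by simp [idt_src]) ≫ comp = 𝟙 arr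
  /-- Associativity, stated for all composable triples `(f, g, h)` of generalised elements of
  `arr`, that is, for all morphisms into the object of composable triples. -/
  assoc : ∀ {T : C} (f g h : T ⟶ arr) (hfg : f ≫ tgt = g ≫ src) (hgh : g ≫ tgt = h ≫ src),
    pullback.lift (pullback.lift f g hfg ≫ comp) h (by simp [comp_tgt, hgh]) ≫ comp =
      pullback.lift f (pullback.lift g h hgh ≫ comp) (by simp [comp_src, hfg]) ≫ comp

namespace InternalCat

variable {C : Type u} [Category.{v} C] [HasPullbacks C]

attribute [simp] idt_src idt_tgt comp_src comp_tgt idt_comp comp_idt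

@[simp] theorem idt_src_assoc (H : InternalCat C) {Z : C} (h : H.obj ⟶ Z) :
    H.idt ≫ H.src ≫ h = h := by rw [← Category.assoc, idt_src, Category.id_comp]

@[simp] theorem idt_tgt_assoc (H : InternalCat C) {Z : C} (h : H.obj ⟶ Z) :
    H.idt ≫ H.tgt ≫ h = h := by rw [← Category.assoc, idt_tgt, Category.id_comp]

/-- Internal functors: an action on objects and an action on arrows, commuting with sources,
targets, identities and composition. -/
@[ext]
structure Hom (H K : InternalCat C) where
  obj : H.obj ⟶ K.obj
  arr : H.arr ⟶ K.arr
  src : H.src ≫ obj = arr ≫ K.src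
  tgt : H.tgt ≫ obj = arr ≫ K.tgt
  idt : H.idt ≫ arr = obj ≫ K.idt
  comp : H.comp ≫ arr =
    pullback.lift (pullback.fst H.tgt H.src ≫ arr) (pullback.snd H.tgt H.src ≫ arr)
      (by rw [Category.assoc, Category.assoc, ← tgt, ← src, pullback.condition_assoc]) ≫ K.comp

/-- The category of internal categories and internal functors in `C`. -/
instance : Category (InternalCat C) where
  Hom := Hom
  id H :=
    { obj := 𝟙 _
      arr := 𝟙 _
      src := by simp
      tgt := by simp
      idt := by simp
      comp := by
        have : pullback.lift (pullback.fst H.tgt H.src ≫ 𝟙 _) (pullback.snd H.tgt H.src ≫ 𝟙 _)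
            (by simp [pullback.condition]) = 𝟙 _ := by
          apply pullback.hom_ext <;> simp
        rw [this]; simp }
  comp F G :=
    { obj := F.obj ≫ G.obj
      arr := F.arr ≫ G.arr
      src := by rw [← Category.assoc, F.src, Category.assoc, G.src, Category.assoc]
      tgt := by rw [← Category.assoc, F.tgt, Category.assoc, G.tgt, Category.assoc]
      idt := by rw [← Category.assoc, F.idt, Category.assoc, G.idt, Category.assoc]
      comp := by
        rw [← Category.assoc, F.comp, Category.assoc, G.comp, ← Category.assoc]
        congr 1
        apply pullback.hom_ext <;> simp }
  id_comp F := by apply Hom.ext <;> simp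
  comp_id F := by apply Hom.ext <;> simp
  assoc F G H := by apply Hom.ext <;> simp

@[ext]
theorem hom_ext {H K : InternalCat C} {F G : H ⟶ K} (h₀ : F.obj = G.obj) (h₁ : F.arr = G.arr) :
    F = G :=
  Hom.ext h₀ h₁

@[simp] theorem id_obj (H : InternalCat C) : Hom.obj (𝟙 H) = 𝟙 H.obj := rfl

@[simp] theorem id_arr (H : InternalCat C) : Hom.arr (𝟙 H) = 𝟙 H.arr := rfl

@[simp] theorem comp_obj {H K L : InternalCat C} (F : H ⟶ K) (G : K ⟶ L) :
    Hom.obj (F ≫ G) = F.obj ≫ G.obj := rfl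

@[simp] theorem comp_arr {H K L : InternalCat C} (F : H ⟶ K) (G : K ⟶ L) :
    Hom.arr (F ≫ G) = F.arr ≫ G.arr := rfl

/-- The functor sending an internal category to its object of objects. -/
@[simps]
def objFunctor (C : Type u) [Category.{v} C] [HasPullbacks C] : InternalCat C ⥤ C where
  obj H := H.obj
  map F := F.obj

/-- The functor sending an internal category to its object of arrows. -/
@[simps]
def arrFunctor (C : Type u) [Category.{v} C] [HasPullbacks C] : InternalCat C ⥤ C where
  obj H := H.arr
  map F := F.arr

/-- An internal functor `Φ : H ⟶ K` is fully faithful if the square formed by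
`Φ₁ : H₁ ⟶ K₁`, `Φ₀ × Φ₀ : H₀ × H₀ ⟶ K₀ × K₀` and the two maps `(s, t)` is a pullback. -/
def IsFullyFaithful [HasBinaryProducts C] {H K : InternalCat C} (Φ : H ⟶ K) : Prop :=
  IsPullback Φ.arr (prod.lift H.src H.tgt) (prod.lift K.src K.tgt) (prod.map Φ.obj Φ.obj)

/-- The class of discrete opfibrations: the internal functors `Φ : H ⟶ K` for which the square
formed by `s : H₁ ⟶ H₀`, `Φ₁`, `Φ₀` and `s : K₁ ⟶ K₀` is a pullback. -/
def discreteOpfibrations (C : Type u) [Category.{v} C] [HasPullbacks C] :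
    MorphismProperty (InternalCat C) :=
  fun H K Φ => IsPullback H.src Φ.arr Φ.obj K.src

/-- The categorically discrete internal category on an object. -/
noncomputable def discrete (Y : C) : InternalCat C where
  obj := Y
  arr := Y
  src := 𝟙 Y
  tgt := 𝟙 Y
  idt := 𝟙 Y
  comp := pullback.fst (𝟙 Y) (𝟙 Y)
  idt_src := by simp
  idt_tgt := by simp
  comp_src := rfl
  comp_tgt := pullback.condition
  idt_comp := by simp
  comp_idt := by simp
  assoc := by simp

/-- The kernel pair `X ×_Y X ⇉ X` of `f : X ⟶ Y`, as an internal category (an internal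
equivalence relation) with object of objects `X`. -/
noncomputable def kernelPair {X Y : C} (f : X ⟶ Y) : InternalCat C where
  obj := X
  arr := pullback f f
  src := pullback.fst f f
  tgt := pullback.snd f f
  idt := pullback.lift (𝟙 X) (𝟙 X) rfl
  comp := pullback.lift
    (pullback.fst (pullback.snd f f) (pullback.fst f f) ≫ pullback.fst f f)
    (pullback.snd (pullback.snd f f) (pullback.fst f f) ≫ pullback.snd f f)
    (by rw [Category.assoc, Category.assoc, pullback.condition, pullback.condition_assoc,
      pullback.condition])
  idt_src := by simp
  idt_tgt := by simp
  comp_src := by simp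
  comp_tgt := by simp
  idt_comp := by apply pullback.hom_ext <;> simp
  comp_idt := by apply pullback.hom_ext <;> simp
  assoc := by intros; apply pullback.hom_ext <;> simp

/-- The morphism `f : X ⟶ Y`, viewed as an internal functor from its kernel pair to the
categorically discrete internal category on `Y`. -/
noncomputable def kernelPairFunctor {X Y : C} (f : X ⟶ Y) : kernelPair f ⟶ discrete Y where
  obj := f
  arr := pullback.fst f f ≫ f
  src := by simp [kernelPair, discrete]
  tgt := by simp [kernelPair, discrete, pullback.condition]
  idt := by simp [kernelPair, discrete]
  comp := by
    dsimp only [kernelPair, discrete]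
    simp only [pullback.lift_fst_assoc, Category.assoc]
    exact (pullback.lift_fst _ _ _).symm

/-- The composite (in diagrammatic order) of two composable generalised arrows. -/
noncomputable def mul (H : InternalCat C) {T : C} (f g : T ⟶ H.arr) (w : f ≫ H.tgt = g ≫ H.src) :
    T ⟶ H.arr :=
  pullback.lift f g w ≫ H.comp

@[simp] theorem mul_src (H : InternalCat C) {T : C} (f g : T ⟶ H.arr)
    (w : f ≫ H.tgt = g ≫ H.src) : H.mul f g w ≫ H.src = f ≫ H.src := by simp [mul]

@[simp] theorem mul_tgt (H : InternalCat C) {T : C} (f g : T ⟶ H.arr)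
    (w : f ≫ H.tgt = g ≫ H.src) : H.mul f g w ≫ H.tgt = g ≫ H.tgt := by simp [mul]

theorem mul_congr (H : InternalCat C) {T : C} {f g f' g' : T ⟶ H.arr} (hf : f = f') (hg : g = g')
    (w : f ≫ H.tgt = g ≫ H.src) : H.mul f g w = H.mul f' g' (by rw [← hf, ← hg, w]) := by
  subst hf hg; rfl

theorem comp_mul (H : InternalCat C) {S T : C} (k : S ⟶ T) (f g : T ⟶ H.arr)
    (w : f ≫ H.tgt = g ≫ H.src) :
    k ≫ H.mul f g w = H.mul (k ≫ f) (k ≫ g) (by simp [w]) := by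
  rw [mul, mul, ← Category.assoc]
  congr 1
  apply pullback.hom_ext <;> simp

theorem mul_map {H K : InternalCat C} (F : H ⟶ K) {T : C} (f g : T ⟶ H.arr)
    (w : f ≫ H.tgt = g ≫ H.src) :
    H.mul f g w ≫ F.arr = K.mul (f ≫ F.arr) (g ≫ F.arr)
      (by rw [Category.assoc, Category.assoc, ← F.src, ← F.tgt, reassoc_of% w]) := by
  rw [mul, mul, Category.assoc, F.comp, ← Category.assoc]
  congr 1
  apply pullback.hom_ext <;> simp

theorem mul_mul (H : InternalCat C) {T : C} (f g h : T ⟶ H.arr)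
    (hfg : f ≫ H.tgt = g ≫ H.src) (hgh : g ≫ H.tgt = h ≫ H.src) :
    H.mul (H.mul f g hfg) h (by simp [hgh]) = H.mul f (H.mul g h hgh) (by simp [hfg]) :=
  H.assoc f g h hfg hgh

theorem idt_mul (H : InternalCat C) {T : C} (f : T ⟶ H.arr) :
    H.mul (f ≫ H.src ≫ H.idt) f (by simp) = f := by
  have h : H.mul (H.src ≫ H.idt) (𝟙 _) (by simp) = 𝟙 _ := H.idt_comp
  have := f ≫= h
  rw [comp_mul] at this
  exact (mul_congr H (by simp) (by simp) _).trans (this.trans (Category.comp_id f))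

theorem mul_idt (H : InternalCat C) {T : C} (f : T ⟶ H.arr) :
    H.mul f (f ≫ H.tgt ≫ H.idt) (by simp) = f := by
  have h : H.mul (𝟙 _) (H.tgt ≫ H.idt) (by simp) = 𝟙 _ := H.comp_idt
  have := f ≫= h
  rw [comp_mul] at this
  exact (mul_congr H (by simp) (by simp) _).trans (this.trans (Category.comp_id f))

section Pullback

variable {A B K : InternalCat C} (F : A ⟶ K) (G : B ⟶ K)

/-- The source map of the pullback of two internal functors. -/
noncomputable def fiberSrc : pullback F.arr G.arr ⟶ pullback F.obj G.obj :=
  pullback.lift (pullback.fst F.arr G.arr ≫ A.src) (pullback.snd F.arr G.arr ≫ B.src)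
    (by rw [Category.assoc, Category.assoc, F.src, G.src, pullback.condition_assoc])

/-- The target map of the pullback of two internal functors. -/
noncomputable def fiberTgt : pullback F.arr G.arr ⟶ pullback F.obj G.obj :=
  pullback.lift (pullback.fst F.arr G.arr ≫ A.tgt) (pullback.snd F.arr G.arr ≫ B.tgt)
    (by rw [Category.assoc, Category.assoc, F.tgt, G.tgt, pullback.condition_assoc])

/-- The identities of the pullback of two internal functors. -/
noncomputable def fiberIdt : pullback F.obj G.obj ⟶ pullback F.arr G.arr :=
  pullback.lift (pullback.fst F.obj G.obj ≫ A.idt) (pullback.snd F.obj G.obj ≫ B.idt)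
    (by rw [Category.assoc, Category.assoc, F.idt, G.idt, pullback.condition_assoc])

theorem fiber_w_fst {F : A ⟶ K} {G : B ⟶ K} {T : C} {f g : T ⟶ pullback F.arr G.arr}
    (w : f ≫ fiberTgt F G = g ≫ fiberSrc F G) :
    (f ≫ pullback.fst _ _) ≫ A.tgt = (g ≫ pullback.fst _ _) ≫ A.src := by
  simpa [fiberTgt, fiberSrc] using w =≫ pullback.fst F.obj G.obj

theorem fiber_w_snd {F : A ⟶ K} {G : B ⟶ K} {T : C} {f g : T ⟶ pullback F.arr G.arr}
    (w : f ≫ fiberTgt F G = g ≫ fiberSrc F G) :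
    (f ≫ pullback.snd _ _) ≫ B.tgt = (g ≫ pullback.snd _ _) ≫ B.src := by
  simpa [fiberTgt, fiberSrc] using w =≫ pullback.snd F.obj G.obj

/-- Composition in the pullback of two internal functors, computed componentwise. -/
noncomputable def fiberMul {T : C} (f g : T ⟶ pullback F.arr G.arr)
    (w : f ≫ fiberTgt F G = g ≫ fiberSrc F G) : T ⟶ pullback F.arr G.arr :=
  pullback.lift
    (A.mul (f ≫ pullback.fst _ _) (g ≫ pullback.fst _ _) (fiber_w_fst w))
    (B.mul (f ≫ pullback.snd _ _) (g ≫ pullback.snd _ _) (fiber_w_snd w))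
    (by
      rw [mul_map, mul_map]
      exact mul_congr K (by simp [pullback.condition]) (by simp [pullback.condition]) _)

theorem fiberMul_fst {T : C} (f g : T ⟶ pullback F.arr G.arr)
    (w : f ≫ fiberTgt F G = g ≫ fiberSrc F G) :
    fiberMul F G f g w ≫ pullback.fst F.arr G.arr =
      A.mul (f ≫ pullback.fst _ _) (g ≫ pullback.fst _ _) (fiber_w_fst w) :=
  pullback.lift_fst _ _ _

theorem fiberMul_snd {T : C} (f g : T ⟶ pullback F.arr G.arr)
    (w : f ≫ fiberTgt F G = g ≫ fiberSrc F G) :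
    fiberMul F G f g w ≫ pullback.snd F.arr G.arr =
      B.mul (f ≫ pullback.snd _ _) (g ≫ pullback.snd _ _) (fiber_w_snd w) :=
  pullback.lift_snd _ _ _

theorem fiberMul_src {T : C} (f g : T ⟶ pullback F.arr G.arr)
    (w : f ≫ fiberTgt F G = g ≫ fiberSrc F G) :
    fiberMul F G f g w ≫ fiberSrc F G = f ≫ fiberSrc F G := by
  apply pullback.hom_ext <;> simp [fiberMul, fiberSrc]

theorem fiberMul_tgt {T : C} (f g : T ⟶ pullback F.arr G.arr)
    (w : f ≫ fiberTgt F G = g ≫ fiberSrc F G) :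
    fiberMul F G f g w ≫ fiberTgt F G = g ≫ fiberTgt F G := by
  apply pullback.hom_ext <;> simp [fiberMul, fiberTgt]

theorem lift_fiberMul {T : C} (f g : T ⟶ pullback F.arr G.arr)
    (w : f ≫ fiberTgt F G = g ≫ fiberSrc F G) :
    pullback.lift f g w ≫ fiberMul F G (pullback.fst _ _) (pullback.snd _ _) pullback.condition =
      fiberMul F G f g w := by
  apply pullback.hom_ext
  · rw [Category.assoc, fiberMul_fst, fiberMul_fst, comp_mul]
    exact mul_congr A (pullback.lift_fst_assoc _ _ _ _) (pullback.lift_snd_assoc _ _ _ _) _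
  · rw [Category.assoc, fiberMul_snd, fiberMul_snd, comp_mul]
    exact mul_congr B (pullback.lift_fst_assoc _ _ _ _) (pullback.lift_snd_assoc _ _ _ _) _

/-- The pullback of two internal functors, computed on objects and on arrows. -/
noncomputable def fiberProduct : InternalCat C where
  obj := pullback F.obj G.obj
  arr := pullback F.arr G.arr
  src := fiberSrc F G
  tgt := fiberTgt F G
  idt := fiberIdt F G
  comp := fiberMul F G (pullback.fst _ _) (pullback.snd _ _) pullback.condition
  idt_src := by apply pullback.hom_ext <;> simp [fiberIdt, fiberSrc]
  idt_tgt := by apply pullback.hom_ext <;> simp [fiberIdt, fiberTgt]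
  comp_src := fiberMul_src F G _ _ _
  comp_tgt := fiberMul_tgt F G _ _ _
  idt_comp := by
    rw [lift_fiberMul]
    apply pullback.hom_ext
    · exact (fiberMul_fst F G _ _ _).trans <| (mul_congr A (by simp [fiberSrc, fiberIdt]) (by simp) _).trans
        ((A.idt_mul _).trans (Category.id_comp _).symm)
    · exact (fiberMul_snd F G _ _ _).trans <| (mul_congr B (by simp [fiberSrc, fiberIdt]) (by simp) _).trans
        ((B.idt_mul _).trans (Category.id_comp _).symm)
  comp_idt := by
    rw [lift_fiberMul]
    apply pullback.hom_ext
    · exact (fiberMul_fst F G _ _ _).trans <| (mul_congr A (by simp) (by simp [fiberTgt, fiberIdt]) _).trans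
        ((A.mul_idt _).trans (Category.id_comp _).symm)
    · exact (fiberMul_snd F G _ _ _).trans <| (mul_congr B (by simp) (by simp [fiberTgt, fiberIdt]) _).trans
        ((B.mul_idt _).trans (Category.id_comp _).symm)
  assoc {T} f g h hfg hgh := by
    simp only [lift_fiberMul]
    apply pullback.hom_ext
    · refine (fiberMul_fst F G _ _ _).trans (Eq.trans ?_ (fiberMul_fst F G _ _ _).symm)
      exact (mul_congr A (fiberMul_fst F G _ _ _) rfl _).trans
        ((A.mul_mul _ _ _ (fiber_w_fst hfg) (fiber_w_fst hgh)).trans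
          (mul_congr A rfl (fiberMul_fst F G _ _ _) _).symm)
    · refine (fiberMul_snd F G _ _ _).trans (Eq.trans ?_ (fiberMul_snd F G _ _ _).symm)
      exact (mul_congr B (fiberMul_snd F G _ _ _) rfl _).trans
        ((B.mul_mul _ _ _ (fiber_w_snd hfg) (fiber_w_snd hgh)).trans
          (mul_congr B rfl (fiberMul_snd F G _ _ _) _).symm)

/-- The first projection. -/
noncomputable def fiberProductFst : fiberProduct F G ⟶ A where
  obj := pullback.fst F.obj G.obj
  arr := pullback.fst F.arr G.arr
  src := pullback.lift_fst _ _ _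
  tgt := pullback.lift_fst _ _ _
  idt := pullback.lift_fst _ _ _
  comp := pullback.lift_fst _ _ _

/-- The second projection. -/
noncomputable def fiberProductSnd : fiberProduct F G ⟶ B where
  obj := pullback.snd F.obj G.obj
  arr := pullback.snd F.arr G.arr
  src := pullback.lift_snd _ _ _
  tgt := pullback.lift_snd _ _ _
  idt := pullback.lift_snd _ _ _
  comp := pullback.lift_snd _ _ _

/-- The universal internal functor into the pullback. -/
noncomputable def fiberProductLift {F : A ⟶ K} {G : B ⟶ K} {T : InternalCat C} (U : T ⟶ A) (V : T ⟶ B)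
    (w : U ≫ F = V ≫ G) : T ⟶ fiberProduct F G where
  obj := pullback.lift U.obj V.obj (congrArg Hom.obj w)
  arr := pullback.lift U.arr V.arr (congrArg Hom.arr w)
  src := by apply pullback.hom_ext <;> simp [fiberProduct, fiberSrc, U.src, V.src]
  tgt := by apply pullback.hom_ext <;> simp [fiberProduct, fiberTgt, U.tgt, V.tgt]
  idt := by apply pullback.hom_ext <;> simp [fiberProduct, fiberIdt, U.idt, V.idt]
  comp := by
    refine Eq.trans ?_ (lift_fiberMul F G _ _ _).symm
    apply pullback.hom_ext
    · refine Eq.trans ?_ (fiberMul_fst F G _ _ _).symm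
      have h₁ : T.comp ≫ U.arr = _ := U.comp
      have h₂ := pullback.lift_fst U.arr V.arr (congrArg Hom.arr w)
      refine ((Category.assoc _ _ _).trans (congrArg (T.comp ≫ ·) h₂)).trans (h₁.trans ?_)
      exact mul_congr A ((congrArg (pullback.fst T.tgt T.src ≫ ·) h₂).symm.trans
        (Category.assoc _ _ _).symm) ((congrArg (pullback.snd T.tgt T.src ≫ ·) h₂).symm.trans
        (Category.assoc _ _ _).symm) _
    · refine Eq.trans ?_ (fiberMul_snd F G _ _ _).symm
      have h₁ : T.comp ≫ V.arr = _ := V.comp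
      have h₂ := pullback.lift_snd U.arr V.arr (congrArg Hom.arr w)
      refine ((Category.assoc _ _ _).trans (congrArg (T.comp ≫ ·) h₂)).trans (h₁.trans ?_)
      exact mul_congr B ((congrArg (pullback.fst T.tgt T.src ≫ ·) h₂).symm.trans
        (Category.assoc _ _ _).symm) ((congrArg (pullback.snd T.tgt T.src ≫ ·) h₂).symm.trans
        (Category.assoc _ _ _).symm) _

theorem isPullback_fiberProduct :
    IsPullback (fiberProductFst F G) (fiberProductSnd F G) F G where
  w := by
    ext
    · exact pullback.condition
    · exact pullback.condition
  isLimit' := ⟨PullbackCone.IsLimit.mk _ (fun s => fiberProductLift s.fst s.snd s.condition)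
    (fun s => by
      ext
      · exact pullback.lift_fst _ _ _
      · exact pullback.lift_fst _ _ _)
    (fun s => by
      ext
      · exact pullback.lift_snd _ _ _
      · exact pullback.lift_snd _ _ _)
    (fun s m h₁ h₂ => by
      ext
      · apply pullback.hom_ext
        · exact (congrArg Hom.obj h₁).trans (pullback.lift_fst _ _ _).symm
        · exact (congrArg Hom.obj h₂).trans (pullback.lift_snd _ _ _).symm
      · apply pullback.hom_ext
        · exact (congrArg Hom.arr h₁).trans (pullback.lift_fst _ _ _).symm
        · exact (congrArg Hom.arr h₂).trans (pullback.lift_snd _ _ _).symm)⟩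

instance : PreservesLimit (cospan F G) (objFunctor C) :=
  (isPullback_fiberProduct F G).preservesLimit_cospan_iff.2 (IsPullback.of_hasPullback F.obj G.obj)

instance : PreservesLimit (cospan F G) (arrFunctor C) :=
  (isPullback_fiberProduct F G).preservesLimit_cospan_iff.2 (IsPullback.of_hasPullback F.arr G.arr)

instance : HasLimit (cospan F G) := (isPullback_fiberProduct F G).hasPullback

end Pullback

/-- Internal categories form a category with pullbacks. -/
instance : HasPullbacks (InternalCat C) := hasPullbacks_of_hasLimit_cospan _

/-- Discrete opfibrations are stable under pullback. -/
instance : (discreteOpfibrations C).IsStableUnderBaseChange where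
  of_isPullback {A B P K F G F' G'} sq hG := by
    have h₀ : IsPullback F'.obj G'.obj G.obj F.obj := sq.map (objFunctor C)
    have h₁ : IsPullback F'.arr G'.arr G.arr F.arr := sq.map (arrFunctor C)
    have hG : IsPullback B.src G.arr G.obj K.src := hG
    have h₂ := h₁.paste_horiz hG
    rw [← F'.src, ← F.src] at h₂
    exact h₂.of_right G'.src h₀

end InternalCat

/-- A morphism `f : X ⟶ Y` of a category with pullbacks is an effective descent morphism if
pullback along `f`, viewed as an internal functor from its kernel pair to the categorically
discrete internal category on `Y`, is an equivalence from the category of discrete opfibrations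
over (the categorically discrete internal category on) `Y` to the category of discrete
opfibrations over the kernel pair of `f`. Morphisms of discrete opfibrations are
all internal functors over the base. -/
def IsEffectiveDescent {D : Type u} [Category.{v} D] [HasPullbacks D] {X Y : D} (f : X ⟶ Y) :
    Prop :=
  (MorphismProperty.Over.pullback (InternalCat.discreteOpfibrations D) ⊤
    (InternalCat.kernelPairFunctor f)).IsEquivalence

end

/-! Effective descent is first put in elementary form: a morphism `f` has it exactly when it is a
stable effective epimorphism and every descent datum along `f` is effective. A descent datum on `α :
A ⟶ X` is an action on generalised elements, which is the same thing as a discrete opfibration over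
the kernel pair of `f`. Full faithfulness of base change corresponds to `f` being a stable effective
epimorphism, and essential surjectivity to effectiveness of descent data. In this form the class is
closed under pullback and composition.

Let `Φ : H ⟶ K` be fully faithful. Then `Φ.arr` factors as `H.arr ⟶ H.obj ×_{K.obj} K.arr ⟶ K.arr`,
adjoining first a lift of the source and then a lift of the target. Both factors are pullbacks of
`Φ.obj`, so `Φ.arr` is of effective descent.

A descent datum for `Φ` on `A ⟶ H` restricts to descent data on objects and on arrows, because these
are computed by functors preserving pullbacks. Both are effective and yield a graph `B₁ ⇉ B₀` over
`K`. Source, target and identities descend since transport commutes with them. For composition,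
composable pairs of `B₁` must be covered by composable pairs of `A`. This is where fullness enters:
an edge of `B₁` lifts to `A` with any prescribed lifts of its two ends. Composable pairs and triples
therefore lift locally, so composition descends and the category axioms are inherited from `A`
(`IsFullCover`). The same lifting shows that pullbacks of `Φ` are effective epimorphisms. -/

section

/-! ### Elementary form of effective descent -/

variable {D : Type u} [Category.{v} D]

/-- A morphism all of whose pullbacks are effective epimorphisms. -/
def IsStableEffectiveEpi {X Y : D} (f : X ⟶ Y) : Prop :=
  ∀ ⦃A B : D⦄ ⦃α : A ⟶ X⦄ ⦃p : A ⟶ B⦄ ⦃b : B ⟶ Y⦄, IsPullback α p f b → EffectiveEpi p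

/-- A descent datum for `f` on `α : A ⟶ X`, as an action on generalised elements: an element
`a` of `A` may be transported to any element `x` of `X` in the same fibre of `f` as `α a`. -/
structure DescentAction {X Y A : D} (f : X ⟶ Y) (α : A ⟶ X) where
  act : ∀ {T : D} (a : T ⟶ A) (x : T ⟶ X), a ≫ α ≫ f = x ≫ f → (T ⟶ A)
  comp_act : ∀ {S T : D} (k : S ⟶ T) (a : T ⟶ A) (x : T ⟶ X) (w : a ≫ α ≫ f = x ≫ f),
    k ≫ act a x w = act (k ≫ a) (k ≫ x) (by simp [w])
  act_proj : ∀ {T : D} (a : T ⟶ A) (x : T ⟶ X) (w : a ≫ α ≫ f = x ≫ f), act a x w ≫ α = x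
  act_self : ∀ {T : D} (a : T ⟶ A), act a (a ≫ α) (by simp) = a
  act_act : ∀ {T : D} (a : T ⟶ A) (x x' : T ⟶ X) (w : a ≫ α ≫ f = x ≫ f) (w' : x ≫ f = x' ≫ f),
    act (act a x w) x' (by rw [← Category.assoc, act_proj, w']) = act a x' (w.trans w')

/-- A descent datum on `α : A ⟶ X` is effective if it is induced by exhibiting `α` as a pullback
along `f` of some morphism into `Y`. -/
def DescentAction.IsEffective {X Y A : D} {f : X ⟶ Y} {α : A ⟶ X} (d : DescentAction f α) : Prop :=
  ∃ (B : D) (b : B ⟶ Y) (p : A ⟶ B), IsPullback α p f b ∧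
    ∀ {T : D} (a : T ⟶ A) (x : T ⟶ X) (w : a ≫ α ≫ f = x ≫ f), d.act a x w ≫ p = a ≫ p

/-- The elementary form of effective descent: `f` is a stable effective epimorphism along which
all descent data are effective. -/
structure HasEffectiveDescent {X Y : D} (f : X ⟶ Y) : Prop where
  stable : IsStableEffectiveEpi f
  effective : ∀ {A : D} {α : A ⟶ X} (d : DescentAction f α), d.IsEffective

/-- Uniqueness of the factorisation is automatic for an epimorphism. -/
theorem effectiveEpi_of_exists {A B : D} (p : A ⟶ B) [Epi p]
    (h : ∀ {W : D} (e : A ⟶ W), (∀ {T : D} (a a' : T ⟶ A), a ≫ p = a' ≫ p → a ≫ e = a' ≫ e) →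
      ∃ g : B ⟶ W, p ≫ g = e) : EffectiveEpi p :=
  ⟨⟨{ desc := fun e he => (h e he).choose
      fac := fun e he => (h e he).choose_spec
      uniq := fun e he m hm => by
        rw [← cancel_epi p, hm, (h e he).choose_spec] }⟩⟩

theorem EffectiveEpi.exists_desc {A B W : D} (p : A ⟶ B) [EffectiveEpi p] (e : A ⟶ W)
    (he : ∀ {T : D} (a a' : T ⟶ A), a ≫ p = a' ≫ p → a ≫ e = a' ≫ e) :
    ∃ g : B ⟶ W, p ≫ g = e :=
  ⟨EffectiveEpi.desc p e he, EffectiveEpi.fac p e he⟩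

/-! ### Stable effective epimorphisms -/

namespace IsStableEffectiveEpi

theorem effectiveEpi {X Y : D} {f : X ⟶ Y} (hf : IsStableEffectiveEpi f) : EffectiveEpi f :=
  hf (IsPullback.of_horiz_isIso (fst := 𝟙 X) (snd := f) (f := f) (g := 𝟙 Y) ⟨by simp⟩)

theorem epi {X Y : D} {f : X ⟶ Y} (hf : IsStableEffectiveEpi f) : Epi f :=
  have := hf.effectiveEpi
  inferInstance

theorem of_isPullback {X Y A B : D} {f : X ⟶ Y} (hf : IsStableEffectiveEpi f) {α : A ⟶ X}
    {p : A ⟶ B} {b : B ⟶ Y} (sq : IsPullback α p f b) : IsStableEffectiveEpi p :=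
  fun _ _ _ _ _ sq' => hf (sq'.flip.paste_vert sq.flip).flip

variable [HasPullbacks D]

/-- The principle of choosing preimages locally: a generalised element of the codomain lifts after
passing to a cover `c`, and equations may then be checked after precomposing with the epimorphism
`c`. -/
theorem exists_lift {X Y T : D} {f : X ⟶ Y} (hf : IsStableEffectiveEpi f) (y : T ⟶ Y) :
    ∃ (S : D) (c : S ⟶ T) (x : S ⟶ X), IsStableEffectiveEpi c ∧ x ≫ f = c ≫ y :=
  ⟨pullback f y, pullback.snd _ _, pullback.fst _ _,
    hf.of_isPullback (IsPullback.of_hasPullback _ _), pullback.condition⟩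

/-- Pull back in two stages `q₁ ≫ q₂` and descend along each in turn. -/
theorem comp {X Y Z : D} {f : X ⟶ Y} {g : Y ⟶ Z} (hf : IsStableEffectiveEpi f)
    (hg : IsStableEffectiveEpi g) : IsStableEffectiveEpi (f ≫ g) := by
  intro A C α q c sq
  have sq₂ := IsPullback.of_hasPullback g c
  have w : (α ≫ f) ≫ g = q ≫ c := by rw [Category.assoc, sq.w]
  have sq₁ : IsPullback α (sq₂.lift (α ≫ f) q w) f (pullback.fst g c) :=
    .flip <| .of_right (by simpa using sq.flip) (by simp) sq₂.flip
  have hq : q = sq₂.lift (α ≫ f) q w ≫ pullback.snd g c := by simp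
  have h₁ := hf.of_isPullback sq₁
  have h₂ := hg.of_isPullback sq₂
  generalize sq₂.lift (α ≫ f) q w = q₁ at hq h₁
  generalize pullback.snd g c = q₂ at hq h₂
  subst hq
  have := h₁.epi
  have := h₂.epi
  have := h₁.effectiveEpi
  have := h₂.effectiveEpi
  refine effectiveEpi_of_exists _ fun {W} e he => ?_
  obtain ⟨e₁, he₁⟩ := EffectiveEpi.exists_desc q₁ e fun a a' h => he a a' (by
    rw [reassoc_of% h])
  obtain ⟨e₂, he₂⟩ := EffectiveEpi.exists_desc q₂ e₁ fun a a' h => by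
    -- Elements identified by `q₂` are lifted locally through `q₁`; their lifts are identified by
    -- the whole composite, so `e` agrees on them.
    obtain ⟨S, c, x, hc, hx⟩ := h₁.exists_lift a
    obtain ⟨S', c', x', hc', hx'⟩ := h₁.exists_lift (c ≫ a')
    have := hc.epi
    have := hc'.epi
    rw [← cancel_epi c, ← cancel_epi c', ← reassoc_of% hx, ← reassoc_of% hx', he₁,
      ← he (c' ≫ x) x' (by simp [reassoc_of% hx, reassoc_of% hx', h]), Category.assoc]
  exact ⟨e₂, by rw [Category.assoc, he₂, he₁]⟩

/-- A morphism with a local section is an effective epimorphism: descend `k ≫ e` along `c`, and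
compare an element of `A` with the value of `k` at a lift of its image. -/
theorem effectiveEpi_of_lift {A B S : D} {c : S ⟶ B} (hc : IsStableEffectiveEpi c) (p : A ⟶ B)
    (k : S ⟶ A) (hk : k ≫ p = c) : EffectiveEpi p := by
  have := hc.effectiveEpi
  have : Epi (k ≫ p) := hk ▸ hc.epi
  have : Epi p := epi_of_epi k p
  refine effectiveEpi_of_exists _ fun {W} e he => ?_
  obtain ⟨g, hg⟩ := EffectiveEpi.exists_desc c (k ≫ e) fun a a' h => by
    rw [← Category.assoc, ← Category.assoc]
    exact he _ _ (by simpa [hk] using h)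
  refine ⟨g, ?_⟩
  obtain ⟨S', c', x, hc', hx⟩ := hc.exists_lift p
  have := hc'.epi
  rw [← cancel_epi c', ← Category.assoc, ← hx, Category.assoc, hg, ← Category.assoc]
  exact he _ _ (by simp [hk, hx])

end IsStableEffectiveEpi

/-! ### Descent data and their images under functors preserving pullbacks -/

namespace DescentAction

variable {X Y A : D} {f : X ⟶ Y} {α : A ⟶ X} (d : DescentAction f α)

theorem act_congr {T : D} {a a' : T ⟶ A} {x x' : T ⟶ X} (ha : a = a') (hx : x = x')
    (w : a ≫ α ≫ f = x ≫ f) : d.act a x w = d.act a' x' (by rw [← ha, ← hx, w]) := by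
  subst ha hx; rfl

/-- If a descent datum comes from a pullback square with projection `p`, then the elements
identified by `p` are those transported to each other. -/
theorem eq_act {B : D} {b : B ⟶ Y} {p : A ⟶ B} (sq : IsPullback α p f b)
    (hp : ∀ {T : D} (a : T ⟶ A) (x : T ⟶ X) (w : a ≫ α ≫ f = x ≫ f), d.act a x w ≫ p = a ≫ p)
    {T : D} {a a' : T ⟶ A} (h : a ≫ p = a' ≫ p) :
    a' = d.act a (a' ≫ α) (by rw [Category.assoc, sq.w, reassoc_of% h]) := by
  apply sq.hom_ext
  · rw [d.act_proj]
  · rw [hp, h]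

/-- The Yoneda principle: an action is determined by its value on the universal compatible pair. -/
theorem lift_act [HasPullbacks D] {T : D} (a : T ⟶ A) (x : T ⟶ X) (w : a ≫ α ≫ f = x ≫ f) :
    pullback.lift a x (by simpa using w) ≫
      d.act (pullback.fst (α ≫ f) f) (pullback.snd _ _) pullback.condition = d.act a x w := by
  rw [d.comp_act]
  exact d.act_congr (pullback.lift_fst _ _ _) (pullback.lift_snd _ _ _) _

section Map

variable {E : Type*} [Category* E] [HasPullbacks D] (F : D ⥤ E)
  [∀ {P Q R : D} (g : P ⟶ R) (h : Q ⟶ R), PreservesLimit (cospan g h) F]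

/-- The action of an element, transported along a functor preserving pullbacks. -/
noncomputable def mapAct {T : E} (a : T ⟶ F.obj A) (x : T ⟶ F.obj X)
    (w : a ≫ F.map α ≫ F.map f = x ≫ F.map f) : T ⟶ F.obj A :=
  ((IsPullback.of_hasPullback (α ≫ f) f).map F).lift a x (by simpa using w) ≫
    F.map (d.act (pullback.fst (α ≫ f) f) (pullback.snd _ _) pullback.condition)

/-- By `exists_eq_comp_map` every compatible pair in `E` has this form, so the laws of the
transported action reduce to those of `d`. -/
theorem mapAct_map {T : D} {S : E} (k : S ⟶ F.obj T) (a : T ⟶ A) (x : T ⟶ X)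
    (w : a ≫ α ≫ f = x ≫ f) :
    d.mapAct F (k ≫ F.map a) (k ≫ F.map x) (by simpa using k ≫= congrArg F.map w) =
      k ≫ F.map (d.act a x w) := by
  rw [← d.lift_act a x w]
  refine Eq.trans ?_ ((Category.assoc _ _ _).trans (congrArg (k ≫ ·) (F.map_comp _ _).symm))
  unfold mapAct
  congr 1
  apply ((IsPullback.of_hasPullback (α ≫ f) f).map F).hom_ext
  · rw [IsPullback.lift_fst, Category.assoc, ← F.map_comp, pullback.lift_fst]
  · rw [IsPullback.lift_snd, Category.assoc, ← F.map_comp, pullback.lift_snd]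

theorem exists_lift_map {T : E} (a : T ⟶ F.obj A) (x : T ⟶ F.obj X)
    (w : a ≫ F.map α ≫ F.map f = x ≫ F.map f) : ∃ k : T ⟶ F.obj (pullback (α ≫ f) f),
      k ≫ F.map (pullback.fst (α ≫ f) f) = a ∧ k ≫ F.map (pullback.snd (α ≫ f) f) = x :=
  ⟨((IsPullback.of_hasPullback (α ≫ f) f).map F).lift a x (by simpa using w), by simp, by simp⟩

theorem exists_eq_comp_map {T : E} (a : T ⟶ F.obj A) (x : T ⟶ F.obj X)
    (w : a ≫ F.map α ≫ F.map f = x ≫ F.map f) :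
    ∃ (R : D) (k : T ⟶ F.obj R) (a' : R ⟶ A) (x' : R ⟶ X), a' ≫ α ≫ f = x' ≫ f ∧
      k ≫ F.map a' = a ∧ k ≫ F.map x' = x :=
  have ⟨k, h₁, h₂⟩ := exists_lift_map F a x w
  ⟨_, k, _, _, by simpa using pullback.condition, h₁, h₂⟩

/-- A functor preserving pullbacks transports descent data. -/
noncomputable def map : DescentAction (F.map f) (F.map α) where
  act := d.mapAct F
  comp_act k a x w := by
    obtain ⟨R, l, a, x, w', rfl, rfl⟩ := exists_eq_comp_map F a x w
    simp only [← Category.assoc, d.mapAct_map F _ a x w']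
  act_proj a x w := by
    obtain ⟨R, l, a, x, w', rfl, rfl⟩ := exists_eq_comp_map F a x w
    rw [d.mapAct_map F _ a x w', Category.assoc, ← F.map_comp, d.act_proj]
  act_self a := by
    have := d.mapAct_map F a (𝟙 A) α (by simp)
    have h : d.act (𝟙 A) α (by simp) = 𝟙 A := by simpa using d.act_self (𝟙 A)
    simpa [h] using this
  act_act {T} a x x' w w' := by
    obtain ⟨R, l, a, x, w₁, rfl, rfl⟩ := exists_eq_comp_map F a x w
    -- `R` carries only `a` and `x`; a further pullback, also preserved by `F`, accommodates `x'`.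
    have sq := (IsPullback.of_hasPullback (x ≫ f) f).map F
    obtain ⟨m, rfl, rfl⟩ : ∃ m : T ⟶ F.obj (pullback (x ≫ f) f),
        m ≫ F.map (pullback.fst (x ≫ f) f) = l ∧ m ≫ F.map (pullback.snd (x ≫ f) f) = x' :=
      ⟨sq.lift l x' (by simpa using w'), by simp, by simp⟩
    have w₂ : pullback.fst (x ≫ f) f ≫ x ≫ f = pullback.snd (x ≫ f) f ≫ f := pullback.condition
    have h := d.act_act (pullback.fst (x ≫ f) f ≫ a) (pullback.fst (x ≫ f) f ≫ x)
      (pullback.snd (x ≫ f) f) (by simp [w₁]) (by simpa using w₂)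
    have h₁ := d.mapAct_map F m (pullback.fst (x ≫ f) f ≫ a) (pullback.fst (x ≫ f) f ≫ x)
      (by simp [w₁])
    have h₂ := d.mapAct_map F m (pullback.fst (x ≫ f) f ≫ a) (pullback.snd (x ≫ f) f)
      (by rw [Category.assoc, w₁, w₂])
    have h₃ := d.mapAct_map F m (d.act (pullback.fst (x ≫ f) f ≫ a) (pullback.fst (x ≫ f) f ≫ x)
      (by simp [w₁])) (pullback.snd (x ≫ f) f)
      (by rw [← Category.assoc, d.act_proj]; simpa using w₂)
    simp only [F.map_comp, ← Category.assoc] at h₁ h₂ h₃ ⊢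
    rw [h₂, ← h]
    simp only [h₁]
    exact h₃

end Map

end DescentAction
end

/-! ### Effective descent under pullback and composition -/

namespace HasEffectiveDescent

variable {D : Type u} [Category.{v} D]

theorem of_isPullback {X Y X' Y' : D} {f : X ⟶ Y} (hf : HasEffectiveDescent f) {u : X' ⟶ X}
    {g : X' ⟶ Y'} {y : Y' ⟶ Y} (sq : IsPullback u g f y) : HasEffectiveDescent g where
  stable := hf.stable.of_isPullback sq
  effective {A α} d := by
    -- A point of `X` in the fibre of `a` over `Y`, together with the image of `a` in `Y'`, is a
    -- point of `X'` to which `d` can transport.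
    let d' : DescentAction f (α ≫ u) :=
      { act := fun a x w => d.act a (sq.lift x (a ≫ α ≫ g) (by simpa [sq.w] using w.symm)) (by simp)
        comp_act := fun k a x w => by
          rw [d.comp_act]
          refine d.act_congr rfl ?_ _
          apply sq.hom_ext <;> simp
        act_proj := fun a x w => by rw [← Category.assoc, d.act_proj, sq.lift_fst]
        act_self := fun a => by
          refine Eq.trans (d.act_congr rfl ?_ _) (d.act_self a)
          apply sq.hom_ext <;> simp
        act_act := fun a x x' w w' => by
          refine Eq.trans (d.act_congr rfl ?_ _) (d.act_act _ _ _ _ ?_)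
          · apply sq.hom_ext <;> simp [reassoc_of% d.act_proj]
          · simp }
    obtain ⟨B, b, p, sq', hp⟩ := hf.effective d'
    have hs := hf.stable.of_isPullback sq'
    have := hs.epi
    have := hs.effectiveEpi
    -- Elements identified by `p` are transports of each other under `d`, which preserves the image
    -- in `Y'`; hence `α ≫ g` descends to `B`.
    obtain ⟨b', hb'⟩ := EffectiveEpi.exists_desc p (α ≫ g) fun {T} a a' h => by
      have ha' : a' = d.act a _ _ := d'.eq_act sq' hp h
      have := congrArg (· ≫ α ≫ g) ha'
      simpa [reassoc_of% d.act_proj] using this.symm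
    have hb : b = b' ≫ y := by
      rw [← cancel_epi p, reassoc_of% hb', ← sq'.w, ← sq.w, Category.assoc]
    subst hb
    refine ⟨B, b', p, sq'.of_right hb'.symm sq, fun a x w => ?_⟩
    rw [← hp a (x ≫ u) (by simp [sq.w, reassoc_of% w])]
    congr 1
    refine d.act_congr rfl ?_ _
    apply sq.hom_ext <;> simp [w]

section Comp

variable {X Y Z A B : D} {f : X ⟶ Y} {g : Y ⟶ Z} {α : A ⟶ X}

/-- A descent datum for a composite restricts to a descent datum for the first morphism. -/
def restrictAction (d : DescentAction (f ≫ g) α) : DescentAction f α where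
  act a x w := d.act a x (by simp [reassoc_of% w])
  comp_act _ _ _ _ := d.comp_act _ _ _ _
  act_proj _ _ _ := d.act_proj _ _ _
  act_self a := d.act_self a
  act_act _ _ _ _ w' := d.act_act _ _ _ _ (by simp [reassoc_of% w'])

variable {b : B ⟶ Y} {p : A ⟶ B} (d : DescentAction (f ≫ g) α) (sq : IsPullback α p f b)
  (hp : ∀ {T : D} (a : T ⟶ A) (x : T ⟶ X) (w : a ≫ α ≫ f = x ≫ f),
    (restrictAction d).act a x w ≫ p = a ≫ p)

include sq hp in
-- Makes the action induced on `B` independent of the chosen lifts: `a'` is a transport of `a` along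
-- `f`, which the action law absorbs, and changing `x` within a fibre of `f` is invisible to `p`.
theorem act_comp_eq_act_comp {T : D} {a a' : T ⟶ A} {x x' : T ⟶ X} (ha : a ≫ p = a' ≫ p)
    (hx : x ≫ f = x' ≫ f) (w : a ≫ α ≫ f ≫ g = x ≫ f ≫ g) (w' : a' ≫ α ≫ f ≫ g = x' ≫ f ≫ g) :
    d.act a x w ≫ p = d.act a' x' w' ≫ p := by
  have h₁ := (restrictAction d).eq_act sq hp ha
  have h₂ : d.act a' x' w' = d.act a x' (by rw [w, reassoc_of% hx]) :=
    (d.act_congr h₁ rfl _).trans (d.act_act _ _ _ _ (by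
      rw [← w', Category.assoc]))
  have h₃ := hp (d.act a x w) x' (by rw [← Category.assoc, d.act_proj, hx])
  rw [h₂, ← h₃]
  congr 1
  exact d.act_act _ _ _ _ (by rw [reassoc_of% hx])

include sq hp in
-- Defines the action on `B` by descent: lift `β` and `y` locally, act in `A`, and project by `p`.
-- Uniqueness later yields several of the action laws.
theorem existsUnique_act [HasPullbacks D] (hf : IsStableEffectiveEpi f) {T : D} (β : T ⟶ B)
    (y : T ⟶ Y)
    (w : β ≫ b ≫ g = y ≫ g) :
    ∃! γ : T ⟶ B, ∀ {S : D} (k : S ⟶ T) (a : S ⟶ A) (x : S ⟶ X) (ha : a ≫ p = k ≫ β)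
      (hx : x ≫ f = k ≫ y), k ≫ γ = d.act a x (by
        rw [reassoc_of% sq.w, reassoc_of% ha, w, reassoc_of% hx]) ≫ p := by
  have hs := hf.of_isPullback sq
  obtain ⟨S₁, c₁, a, hc₁, ha⟩ := hs.exists_lift β
  obtain ⟨S, c₂, x, hc₂, hx⟩ := hf.exists_lift (c₁ ≫ y)
  have hc := hc₂.comp hc₁
  have := hc.epi
  have := hc.effectiveEpi
  have w₁ : (c₂ ≫ a) ≫ α ≫ f ≫ g = x ≫ f ≫ g := by
    rw [Category.assoc, reassoc_of% sq.w, reassoc_of% ha, w, reassoc_of% hx]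
  obtain ⟨γ, hγ⟩ := EffectiveEpi.exists_desc (c₂ ≫ c₁) (d.act (c₂ ≫ a) x w₁ ≫ p)
    fun s s' h => by
      rw [← Category.assoc, ← Category.assoc, d.comp_act, d.comp_act]
      apply act_comp_eq_act_comp d sq hp
      · simp [ha, reassoc_of% h]
      · simp [hx, reassoc_of% h]
  refine ⟨γ, fun {R} k a' x' ha' hx' => ?_, fun γ' hγ' => ?_⟩
  · obtain ⟨R', c', s, hc', hs'⟩ := hc.exists_lift k
    have := hc'.epi
    rw [← cancel_epi c', ← reassoc_of% hs', ← Category.assoc c₂, hγ, ← Category.assoc,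
      ← Category.assoc c', d.comp_act, d.comp_act]
    apply act_comp_eq_act_comp d sq hp
    · simp [ha, ha', reassoc_of% hs']
    · simp [hx, hx', reassoc_of% hs']
  · rw [← cancel_epi (c₂ ≫ c₁), hγ]
    exact hγ' _ _ _ (by simp [ha]) (by simp [hx])

/-- Descend in two steps: effectiveness along `f` produces `B` over `Y`, the remaining part of `d`
becomes an action on `B` along `g`, and the two resulting pullback squares paste. -/
theorem comp [HasPullbacks D] (hf : HasEffectiveDescent f) (hg : HasEffectiveDescent g) :
    HasEffectiveDescent (f ≫ g) where
  stable := hf.stable.comp hg.stable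
  effective {A α} d := by
    obtain ⟨B, b, p, sq, hp⟩ := hf.effective (restrictAction d)
    have hs := hf.stable.of_isPullback sq
    choose γ hγ huniq using fun {T : D} (β : T ⟶ B) (y : T ⟶ Y) (w : β ≫ b ≫ g = y ≫ g) =>
      existsUnique_act d sq hp hf.stable β y w
    let d₂ : DescentAction g b :=
      { act := γ
        comp_act := fun k β y w => huniq _ _ _ _ fun l a x ha hx => by
          rw [← Category.assoc]
          exact hγ β y w (l ≫ k) a x (by simpa using ha) (by simpa using hx)
        act_proj := fun β y w => by
          obtain ⟨S₁, c₁, a, hc₁, ha⟩ := hs.exists_lift β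
          obtain ⟨S, c₂, x, hc₂, hx⟩ := hf.stable.exists_lift (c₁ ≫ y)
          have := (hc₂.comp hc₁).epi
          rw [← cancel_epi (c₂ ≫ c₁), ← Category.assoc,
            hγ β y w (c₂ ≫ c₁) (c₂ ≫ a) x (by simp [ha]) (by simp [hx]), Category.assoc]
          refine (congrArg (_ ≫ ·) sq.w.symm).trans ?_
          rw [← Category.assoc, d.act_proj, hx, Category.assoc]
        act_self := fun β => (huniq _ _ _ β fun k a x ha hx =>
          ha.symm.trans (hp a x (by rw [sq.w, reassoc_of% ha, hx])).symm).symm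
        act_act := fun β y y' w w' => by
          obtain ⟨S₁, c₁, a, hc₁, ha⟩ := hs.exists_lift β
          obtain ⟨S₂, c₂, x, hc₂, hx⟩ := hf.stable.exists_lift (c₁ ≫ y)
          obtain ⟨S, c₃, x', hc₃, hx'⟩ := hf.stable.exists_lift (c₂ ≫ c₁ ≫ y')
          have := (hc₃.comp (hc₂.comp hc₁)).epi
          have h₁ := hγ β y w (c₃ ≫ c₂ ≫ c₁) (c₃ ≫ c₂ ≫ a) (c₃ ≫ x) (by simp [ha]) (by simp [hx])
          rw [← cancel_epi (c₃ ≫ c₂ ≫ c₁),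
            hγ β y' _ (c₃ ≫ c₂ ≫ c₁) (c₃ ≫ c₂ ≫ a) x' (by simp [ha]) (by simp [hx']),
            hγ _ y' _ (c₃ ≫ c₂ ≫ c₁) _ x' h₁.symm (by simp [hx'])]
          congr 1
          exact d.act_act _ _ _ _ (by simp [reassoc_of% hx, reassoc_of% hx', w']) }
    obtain ⟨E, e, q, sq₂, hq⟩ := hg.effective d₂
    refine ⟨E, e, p ≫ q, sq.paste_vert sq₂, fun {T} a x w => ?_⟩
    have h₁ := hγ (a ≫ p) (x ≫ f) (by simpa [← reassoc_of% sq.w] using w) (𝟙 T) a x (by simp)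
      (by simp)
    have h₂ : γ (a ≫ p) (x ≫ f) _ ≫ q = _ := hq (a ≫ p) (x ≫ f)
      (by simpa [← reassoc_of% sq.w] using w)
    rw [Category.id_comp] at h₁
    rw [← Category.assoc, ← h₁, h₂, Category.assoc]

end Comp

end HasEffectiveDescent

/-! ### Base change as an equivalence, in terms of arbitrary pullback squares -/

namespace CategoryTheory.MorphismProperty

/-- An unbundled criterion for base change along `f` to be an equivalence on the full
subcategories of over categories cut out by a stable class of morphisms. -/
theorem over_pullback_isEquivalence_iff {E : Type*} [Category* E] [HasPullbacks E]
    (P : MorphismProperty E) [P.IsStableUnderBaseChange] {X Y : E} (f : X ⟶ Y) :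
    (MorphismProperty.Over.pullback P ⊤ f).IsEquivalence ↔
      (∀ {A B Q : E} {a : A ⟶ Y} {b : B ⟶ Y} {u : Q ⟶ A} {c : Q ⟶ X}, P a → P b →
        IsPullback u c a f → ∀ w : Q ⟶ B, w ≫ b = u ≫ a →
          ∃! h : A ⟶ B, h ≫ b = a ∧ u ≫ h = w) ∧
      (∀ {Q : E} {c : Q ⟶ X}, P c →
        ∃ (A : E) (a : A ⟶ Y) (u : Q ⟶ A), P a ∧ IsPullback u c a f) := by
  constructor
  · intro h
    refine ⟨fun {A B Q a b u c} ha hb sq w hw => ?_, fun {Q c} hc => ?_⟩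
    · let A' : P.Over ⊤ Y := MorphismProperty.Over.mk ⊤ a ha
      let B' : P.Over ⊤ Y := MorphismProperty.Over.mk ⊤ b hb
      let e : Q ≅ pullback a f := sq.isoPullback
      have he₁ : e.inv ≫ u = pullback.fst a f := sq.isoPullback_inv_fst
      have he₂ : e.inv ≫ c = pullback.snd a f := sq.isoPullback_inv_snd
      have he₃ : e.hom ≫ pullback.fst a f = u := sq.isoPullback_hom_fst
      let w₀ : pullback a f ⟶ pullback b f := pullback.lift (e.inv ≫ w) (pullback.snd a f)
        (by rw [Category.assoc, hw, reassoc_of% he₁, pullback.condition])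
      let w' : (MorphismProperty.Over.pullback P ⊤ f).obj A' ⟶
          (MorphismProperty.Over.pullback P ⊤ f).obj B' :=
        MorphismProperty.Over.homMk w₀ (pullback.lift_snd _ _ _) trivial
      -- Translates between morphisms out of the arbitrary pullback `Q` and morphisms between the
      -- chosen pullbacks, so that fullness gives existence and faithfulness gives uniqueness.
      have key : ∀ k : A' ⟶ B', (MorphismProperty.Over.pullback P ⊤ f).map k = w' ↔
          u ≫ k.left = w := by
        intro k
        let k₀ : A ⟶ B := k.left
        have hk₀ : k₀ ≫ b = a := MorphismProperty.Over.w k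
        let k₁ : pullback a f ⟶ pullback b f := pullback.lift (pullback.fst a f ≫ k₀)
          (pullback.snd a f) (by rw [Category.assoc, hk₀, pullback.condition])
        change _ ↔ u ≫ k₀ = w
        constructor
        · intro hk
          have hk₁ : k₁ = w₀ := congrArg (fun m => CommaMorphism.left m.hom) hk
          have := e.hom ≫= hk₁ =≫ pullback.fst b f
          simpa [k₁, w₀, reassoc_of% he₃, pullback.lift_fst] using this
        · intro hk
          have hk₁ : k₁ = w₀ := by
            apply pullback.hom_ext <;> simp [k₁, w₀, ← hk, reassoc_of% he₁, pullback.lift_fst,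
              pullback.lift_snd]
          exact MorphismProperty.Over.Hom.ext hk₁
      obtain ⟨k, hk⟩ := (MorphismProperty.Over.pullback P ⊤ f).map_surjective w'
      refine ⟨k.left, ⟨MorphismProperty.Over.w k, (key k).1 hk⟩, ?_⟩
      rintro l ⟨hl₁, hl₂⟩
      let l' : A' ⟶ B' := MorphismProperty.Over.homMk l hl₁ trivial
      have : l' = k := (MorphismProperty.Over.pullback P ⊤ f).map_injective
        (((key l').2 hl₂).trans hk.symm)
      exact congrArg (fun m => CommaMorphism.left m.hom) this
    · let Q' : P.Over ⊤ X := MorphismProperty.Over.mk ⊤ c hc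
      let A := (MorphismProperty.Over.pullback P ⊤ f).objPreimage Q'
      let e := (MorphismProperty.Over.pullback P ⊤ f).objObjPreimageIso Q'
      let e' : pullback A.hom f ≅ Q :=
        (MorphismProperty.Over.forget P ⊤ X ⋙ CategoryTheory.Over.forget X).mapIso e
      have he : e'.inv ≫ pullback.snd A.hom f = c := MorphismProperty.Over.w e.inv
      refine ⟨A.left, A.hom, e'.inv ≫ pullback.fst A.hom f, A.prop, ?_⟩
      exact IsPullback.of_iso (IsPullback.of_hasPullback A.hom f) e' (Iso.refl _) (Iso.refl _)
        (Iso.refl _) (by simp) (by simp [← he]) (by simp) (by simp)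
  · rintro ⟨h₁, h₂⟩
    have h₃ : ∀ {A B : P.Over ⊤ Y} (k : A ⟶ B),
        pullback.fst A.hom f ≫ k.left =
          ((MorphismProperty.Over.pullback P ⊤ f).map k).left ≫ pullback.fst B.hom f :=
      fun k => (pullback.lift_fst _ _ _).symm
    exact
    { faithful := ⟨fun {A B k l} hkl => by
        apply MorphismProperty.Over.Hom.ext
        refine (h₁ A.prop B.prop (IsPullback.of_hasPullback A.hom f) (pullback.fst A.hom f ≫ k.left)
          ?_).unique ⟨MorphismProperty.Over.w k, rfl⟩ ⟨MorphismProperty.Over.w l, ?_⟩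
        · rw [Category.assoc]
          exact congrArg (_ ≫ ·) (MorphismProperty.Over.w k)
        · rw [h₃, h₃, hkl]⟩
      full := ⟨fun {A B} k => by
        let k₀ : pullback A.hom f ⟶ pullback B.hom f := k.left
        have hk : k₀ ≫ pullback.snd B.hom f = pullback.snd A.hom f := MorphismProperty.Over.w k
        obtain ⟨l, ⟨hl₁, hl₂⟩, -⟩ := h₁ A.prop B.prop (IsPullback.of_hasPullback A.hom f)
          (k₀ ≫ pullback.fst B.hom f)
          (by rw [Category.assoc, pullback.condition, reassoc_of% hk, pullback.condition])
        refine ⟨MorphismProperty.Over.homMk l hl₁ trivial, ?_⟩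
        apply MorphismProperty.Over.Hom.ext
        apply pullback.hom_ext
        · exact (h₃ _).symm.trans hl₂
        · exact (pullback.lift_snd _ _ _).trans hk.symm⟩
      essSurj := ⟨fun Q => by
        obtain ⟨A, a, u, ha, sq⟩ := h₂ Q.prop
        exact ⟨MorphismProperty.Over.mk ⊤ a ha, ⟨(MorphismProperty.Over.isoMk sq.isoPullback
          (IsPullback.isoPullback_hom_snd _)).symm⟩⟩⟩ }

end CategoryTheory.MorphismProperty

/-! ### Internal functors, pullbacks and discrete opfibrations via generalised elements -/

namespace InternalCat

variable {C : Type u} [Category.{v} C] [HasPullbacks C]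

theorem idt_map {H K : InternalCat C} (F : H ⟶ K) : H.idt ≫ F.arr = F.obj ≫ K.idt := Hom.idt F

theorem src_map {H K : InternalCat C} (F : H ⟶ K) : H.src ≫ F.obj = F.arr ≫ K.src := Hom.src F

theorem tgt_map {H K : InternalCat C} (F : H ⟶ K) : H.tgt ≫ F.obj = F.arr ≫ K.tgt := Hom.tgt F

theorem comp_eq_mul (H : InternalCat C) :
    H.comp = H.mul (pullback.fst H.tgt H.src) (pullback.snd H.tgt H.src) pullback.condition := by
  have : pullback.lift (pullback.fst H.tgt H.src) (pullback.snd H.tgt H.src)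
      pullback.condition = 𝟙 _ := by
    apply pullback.hom_ext
    · simp
    · simp
  rw [mul, this, Category.id_comp]

/-- An internal functor from a morphism on objects and one on arrows, with preservation of
composites expressed in terms of `mul`. -/
def homMk {H K : InternalCat C} (obj : H.obj ⟶ K.obj) (arr : H.arr ⟶ K.arr)
    (src : H.src ≫ obj = arr ≫ K.src) (tgt : H.tgt ≫ obj = arr ≫ K.tgt)
    (idt : H.idt ≫ arr = obj ≫ K.idt)
    (comp : ∀ {T : C} (f g : T ⟶ H.arr) (w : f ≫ H.tgt = g ≫ H.src),
      H.mul f g w ≫ arr = K.mul (f ≫ arr) (g ≫ arr)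
        (by rw [Category.assoc, Category.assoc, ← tgt, ← src, reassoc_of% w])) : H ⟶ K where
  obj := obj
  arr := arr
  src := src
  tgt := tgt
  idt := idt
  comp := by
    have := comp _ _ (pullback.condition (f := H.tgt) (g := H.src))
    rwa [← comp_eq_mul] at this

/-- A square of internal functors that is a pullback on objects and on arrows is a pullback. -/
theorem isPullback_of_obj_arr {P A B K : InternalCat C} {U : P ⟶ A} {V : P ⟶ B} {F : A ⟶ K}
    {G : B ⟶ K} (h₀ : IsPullback U.obj V.obj F.obj G.obj)
    (h₁ : IsPullback U.arr V.arr F.arr G.arr) : IsPullback U V F G where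
  w := by
    ext
    · exact h₀.w
    · exact h₁.w
  isLimit' := by
    have hl : ∀ s : PullbackCone F G, ∃ l : s.pt ⟶ P, l ≫ U = s.fst ∧ l ≫ V = s.snd := by
      intro s
      have e₀ : s.fst.obj ≫ F.obj = s.snd.obj ≫ G.obj := congrArg Hom.obj s.condition
      have e₁ : s.fst.arr ≫ F.arr = s.snd.arr ≫ G.arr := congrArg Hom.arr s.condition
      refine ⟨homMk (h₀.lift _ _ e₀) (h₁.lift _ _ e₁) ?_ ?_ ?_ ?_, ?_, ?_⟩
      · apply h₀.hom_ext
        · simp [src_map]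
        · simp [src_map]
      · apply h₀.hom_ext
        · simp [tgt_map]
        · simp [tgt_map]
      · apply h₁.hom_ext
        · simp [idt_map]
        · simp [idt_map]
      · intro T f g w
        apply h₁.hom_ext
        · rw [Category.assoc, h₁.lift_fst, mul_map, mul_map]
          exact mul_congr _ (by simp) (by simp) _
        · rw [Category.assoc, h₁.lift_snd, mul_map, mul_map]
          exact mul_congr _ (by simp) (by simp) _
      · ext
        · exact h₀.lift_fst _ _ _
        · exact h₁.lift_fst _ _ _
      · ext
        · exact h₀.lift_snd _ _ _
        · exact h₁.lift_snd _ _ _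
    exact ⟨PullbackCone.IsLimit.mk _ (fun s => (hl s).choose)
      (fun s => (hl s).choose_spec.1) (fun s => (hl s).choose_spec.2)
      (fun s m e₁ e₂ => by
        have e₁' := e₁.trans (hl s).choose_spec.1.symm
        have e₂' := e₂.trans (hl s).choose_spec.2.symm
        ext
        · exact h₀.hom_ext (congrArg Hom.obj e₁') (congrArg Hom.obj e₂')
        · exact h₁.hom_ext (congrArg Hom.arr e₁') (congrArg Hom.arr e₂'))⟩

theorem isPullback_obj {P A B K : InternalCat C} {U : P ⟶ A} {V : P ⟶ B} {F : A ⟶ K}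
    {G : B ⟶ K} (h : IsPullback U V F G) : IsPullback U.obj V.obj F.obj G.obj :=
  h.map (objFunctor C)

theorem isPullback_arr {P A B K : InternalCat C} {U : P ⟶ A} {V : P ⟶ B} {F : A ⟶ K}
    {G : B ⟶ K} (h : IsPullback U V F G) : IsPullback U.arr V.arr F.arr G.arr :=
  h.map (arrFunctor C)

section DiscreteOpfibration

variable {Q K : InternalCat C} {c : Q ⟶ K}

theorem discreteOpfibrations_iff :
    discreteOpfibrations C c ↔ IsPullback Q.src c.arr c.obj K.src := Iff.rfl

/-- The lift of an arrow of the base of a discrete opfibration with given source. -/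
noncomputable def liftArr (hc : discreteOpfibrations C c) {T : C} (a : T ⟶ Q.obj) (k : T ⟶ K.arr)
    (w : a ≫ c.obj = k ≫ K.src) : T ⟶ Q.arr :=
  IsPullback.lift hc a k w

section

variable (hc : discreteOpfibrations C c) {T : C} (a : T ⟶ Q.obj) (k : T ⟶ K.arr)
    (w : a ≫ c.obj = k ≫ K.src)

@[simp]
theorem liftArr_src : liftArr hc a k w ≫ Q.src = a := IsPullback.lift_fst _ _ _ _

@[simp]
theorem liftArr_map : liftArr hc a k w ≫ c.arr = k := IsPullback.lift_snd _ _ _ _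

end

end DiscreteOpfibration

/-! ### Internal categories with only identity arrows -/

section Discrete

instance (Y : C) : IsIso (discrete Y).src := inferInstanceAs (IsIso (𝟙 Y))

variable {E P : InternalCat C}

/-- Invertibility of the source map is used in place of literal discreteness because it passes to
every discrete opfibration over such a base. -/
theorem isIso_src_of_discreteOpfibration {K : InternalCat C} [IsIso K.src] {a : E ⟶ K}
    (ha : discreteOpfibrations C a) : IsIso E.src :=
  (discreteOpfibrations_iff.1 ha).isIso_fst_of_isIso

variable [IsIso E.src]

theorem hom_ext_of_isIso_src {U V : P ⟶ E} (h : U.obj = V.obj) : U = V := by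
  ext
  · exact h
  · rw [← cancel_mono E.src, ← src_map, ← src_map, h]

theorem discreteOpfibrations_of_isIso_src [IsIso P.src] (U : P ⟶ E) : discreteOpfibrations C U :=
  discreteOpfibrations_iff.2 (IsPullback.of_horiz_isIso ⟨src_map _⟩)

variable (E) in
-- The identities are a section of the source, hence its inverse, and they are also a section of the
-- target.
theorem src_eq_tgt_of_isIso_src : E.src = E.tgt := by
  have h : E.src ≫ E.idt = 𝟙 _ := by
    rw [← cancel_mono E.src]
    simp
  simpa using h =≫ E.tgt

theorem src_obj_eq_tgt_obj (U : P ⟶ E) : P.src ≫ U.obj = P.tgt ≫ U.obj := by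
  rw [src_map, tgt_map, src_eq_tgt_of_isIso_src]

/-- An internal functor into an internal category with only identities, from a morphism
on objects coequalizing source and target. -/
noncomputable def homOfObj (g : P.obj ⟶ E.obj) (hg : P.src ≫ g = P.tgt ≫ g) : P ⟶ E :=
  homMk g (P.src ≫ g ≫ E.idt) (by simp) (by simp [hg]) (by simp) fun f f' w => by
    rw [← cancel_mono E.src]
    simp [reassoc_of% mul_src]

@[simp] theorem homOfObj_obj (g : P.obj ⟶ E.obj) (hg : P.src ≫ g = P.tgt ≫ g) :
    (homOfObj g hg).obj = g := rfl

end Discrete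

end InternalCat

/-! ### Discrete opfibrations over a kernel pair as descent data -/

namespace InternalCat

variable {C : Type u} [Category.{v} C] [HasPullbacks C]

section KernelPair

variable {Y : C} {Q R : InternalCat C} {f : R.obj ⟶ Y} (hR : IsKernelPair f R.src R.tgt)
  {c : Q ⟶ R} (hc : discreteOpfibrations C c)

include hR in
theorem map_src_comp_eq (c : Q ⟶ R) : Q.src ≫ c.obj ≫ f = Q.tgt ≫ c.obj ≫ f := by
  rw [← Category.assoc, ← Category.assoc, src_map, tgt_map, Category.assoc, Category.assoc, hR.w]

/-- The lift, to a discrete opfibration over a kernel pair, of the arrow between two elements of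
the same fibre. -/
noncomputable def transportArr {T : C} (a : T ⟶ Q.obj) (x : T ⟶ R.obj)
    (w : a ≫ c.obj ≫ f = x ≫ f) : T ⟶ Q.arr :=
  liftArr hc a (IsPullback.lift hR (a ≫ c.obj) x (by rw [← w, Category.assoc]))
    (IsPullback.lift_fst _ _ _ _).symm

@[simp] theorem transportArr_src {T : C} (a : T ⟶ Q.obj) (x : T ⟶ R.obj)
    (w : a ≫ c.obj ≫ f = x ≫ f) : transportArr hR hc a x w ≫ Q.src = a :=
  liftArr_src _ _ _ _

theorem transportArr_tgt_map {T : C} (a : T ⟶ Q.obj) (x : T ⟶ R.obj)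
    (w : a ≫ c.obj ≫ f = x ≫ f) : transportArr hR hc a x w ≫ Q.tgt ≫ c.obj = x := by
  rw [tgt_map, ← Category.assoc, transportArr, liftArr_map, IsPullback.lift_snd]

include hR hc in
-- An arrow of `Q` is determined by its source and its image in `R`, and an arrow of a kernel pair
-- by its two ends.
theorem arr_hom_ext {T : C} {e e' : T ⟶ Q.arr} (h₁ : e ≫ Q.src = e' ≫ Q.src)
    (h₂ : e ≫ Q.tgt ≫ c.obj = e' ≫ Q.tgt ≫ c.obj) : e = e' := by
  apply IsPullback.hom_ext hc h₁
  apply IsPullback.hom_ext hR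
  · rw [Category.assoc, Category.assoc, ← src_map, reassoc_of% h₁]
  · rw [Category.assoc, Category.assoc, ← tgt_map, h₂]

theorem eq_transportArr {T : C} {e : T ⟶ Q.arr} {a : T ⟶ Q.obj} {x : T ⟶ R.obj}
    (h₁ : e ≫ Q.src = a) (h₂ : e ≫ Q.tgt ≫ c.obj = x) (w : a ≫ c.obj ≫ f = x ≫ f) :
    e = transportArr hR hc a x w :=
  arr_hom_ext hR hc (by simp [h₁]) (by rw [transportArr_tgt_map, h₂])

/-- The descent datum given by a discrete opfibration over a kernel pair. -/
noncomputable def descentAction : DescentAction f c.obj where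
  act a x w := transportArr hR hc a x w ≫ Q.tgt
  comp_act k a x w := by
    rw [← Category.assoc]
    congr 1
    apply eq_transportArr
    · simp
    · rw [Category.assoc, transportArr_tgt_map]
  act_proj a x w := by rw [Category.assoc, transportArr_tgt_map]
  act_self a := by
    rw [← eq_transportArr hR hc (e := a ≫ Q.idt)]
    · simp
    · simp
    · simp
  act_act a x x' w w' := by
    have h₁ := transportArr_tgt_map hR hc a x w
    have h₂ : (transportArr hR hc a x w ≫ Q.tgt) ≫ c.obj ≫ f = x' ≫ f := by
      rw [Category.assoc, reassoc_of% h₁, w']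
    rw [← eq_transportArr hR hc (a := a) (x := x') (e := Q.mul (transportArr hR hc a x w)
      (transportArr hR hc _ x' h₂) (transportArr_src _ _ _ _ _).symm), mul_tgt]
    · simp
    · rw [← Category.assoc, mul_tgt, Category.assoc, transportArr_tgt_map]

/-- The universal arrow of `Q` is itself a transport, so a morphism invariant under the action
coequalizes source and target. -/
theorem act_src : (descentAction hR hc).act Q.src (Q.tgt ≫ c.obj)
    (by rw [map_src_comp_eq hR, Category.assoc]) = Q.tgt :=
  (congrArg (· ≫ Q.tgt)
    (eq_transportArr hR hc (Category.id_comp _) (Category.id_comp _) _).symm).trans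
    (Category.id_comp _)

end KernelPair

section ActionCat

variable {X Y : C} {f : X ⟶ Y} {A : C} {α : A ⟶ X} (d : DescentAction f α)

/-- The internal category of a descent datum: its arrows `a ⟶ act a x` are the pairs of an
element and an element of the base to which it may be transported. -/
noncomputable def actionCat : InternalCat C :=
  have w₁ : pullback.fst (α ≫ f) f ≫ α ≫ f = pullback.snd (α ≫ f) f ≫ f := pullback.condition
  have hl : ∀ {T : C} (k : T ⟶ pullback (α ≫ f) f),
      k ≫ d.act (pullback.fst (α ≫ f) f) (pullback.snd (α ≫ f) f) w₁ =
        d.act (k ≫ pullback.fst (α ≫ f) f) (k ≫ pullback.snd (α ≫ f) f) (by simp [w₁]) :=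
    fun k => d.comp_act _ _ _ _
  -- For a composable pair, the point to which the first arrow transports is the base point of the
  -- source of the second.
  have hm : pullback.fst (d.act (pullback.fst (α ≫ f) f) (pullback.snd (α ≫ f) f) w₁)
      (pullback.fst (α ≫ f) f) ≫ pullback.snd (α ≫ f) f =
      pullback.snd (d.act (pullback.fst (α ≫ f) f) (pullback.snd (α ≫ f) f) w₁)
      (pullback.fst (α ≫ f) f) ≫ pullback.fst (α ≫ f) f ≫ α := by
    rw [← pullback.condition_assoc, d.act_proj]
  { obj := A
    arr := pullback (α ≫ f) f
    src := pullback.fst _ _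
    tgt := d.act (pullback.fst _ _) (pullback.snd _ _) w₁
    idt := pullback.lift (𝟙 A) α (by simp)
    comp := pullback.lift (pullback.fst _ _ ≫ pullback.fst _ _)
      (pullback.snd _ _ ≫ pullback.snd _ _)
      (by rw [Category.assoc, w₁, reassoc_of% hm, Category.assoc, w₁])
    idt_src := pullback.lift_fst _ _ _
    idt_tgt := by
      rw [hl]
      refine (d.act_congr (pullback.lift_fst _ _ _) ((pullback.lift_snd _ _ _).trans
        (Category.id_comp α).symm) _).trans (d.act_self (𝟙 A))
    comp_src := pullback.lift_fst _ _ _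
    comp_tgt := by
      rw [hl, hl]
      refine (d.act_congr (pullback.lift_fst _ _ _) (pullback.lift_snd _ _ _) _).trans ?_
      refine (d.act_act _ (pullback.fst _ _ ≫ pullback.snd _ _) _ ?_ ?_).symm.trans
        (d.act_congr ?_ rfl _)
      · rw [Category.assoc, Category.assoc, w₁]
      · rw [Category.assoc, Category.assoc, reassoc_of% hm, w₁]
      · rw [← hl, pullback.condition]
    idt_comp := by
      apply pullback.hom_ext <;> simp [pullback.lift_fst, pullback.lift_snd,
        pullback.lift_fst_assoc, pullback.lift_snd_assoc]
    comp_idt := by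
      apply pullback.hom_ext <;> simp [pullback.lift_fst, pullback.lift_snd,
        pullback.lift_fst_assoc, pullback.lift_snd_assoc, d.act_proj]
    assoc := by
      intros
      apply pullback.hom_ext <;> simp [pullback.lift_fst, pullback.lift_snd,
        pullback.lift_fst_assoc, pullback.lift_snd_assoc] }

end ActionCat

end InternalCat

namespace InternalCat

variable {C : Type u} [Category.{v} C] [HasPullbacks C]

/-- An internal functor into a kernel pair is determined by compatible maps on objects and on
arrows. -/
def homOfKernelPair {Q R : InternalCat C} {Y : C} {f : R.obj ⟶ Y}
    (hR : IsKernelPair f R.src R.tgt) (obj : Q.obj ⟶ R.obj) (arr : Q.arr ⟶ R.arr)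
    (src : Q.src ≫ obj = arr ≫ R.src) (tgt : Q.tgt ≫ obj = arr ≫ R.tgt) : Q ⟶ R :=
  homMk obj arr src tgt
    (IsPullback.hom_ext hR (by simp [← src]) (by simp [← tgt]))
    fun g g' w => IsPullback.hom_ext hR
      (by rw [mul_src, Category.assoc, Category.assoc, ← src, ← Category.assoc, mul_src,
        Category.assoc])
      (by rw [mul_tgt, Category.assoc, Category.assoc, ← tgt, ← Category.assoc, mul_tgt,
        Category.assoc])

section ActionCat

variable {X Y : C} {f : X ⟶ Y} {A : C} {α : A ⟶ X} (d : DescentAction f α)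

/-- The projection from the internal category of a descent datum to the kernel pair. -/
noncomputable def actionCatProj : actionCat d ⟶ kernelPair f :=
  have w : (pullback.fst (α ≫ f) f ≫ α) ≫ f = pullback.snd (α ≫ f) f ≫ f := by
    rw [Category.assoc, pullback.condition]
  homOfKernelPair (Q := actionCat d) (R := kernelPair f) (f := f) (IsPullback.of_hasPullback f f) α
    (pullback.lift (pullback.fst (α ≫ f) f ≫ α) (pullback.snd (α ≫ f) f) w)
    (pullback.lift_fst _ _ _).symm
    ((d.act_proj _ _ _).trans (pullback.lift_snd _ _ _).symm)

/-- Pullback cancellation: pulling `α` back along the first projection of the kernel pair gives the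
pullback of `α ≫ f` along `f`. -/
theorem discreteOpfibrations_actionCatProj : discreteOpfibrations C (actionCatProj d) := by
  have w : (pullback.fst (α ≫ f) f ≫ α) ≫ f = pullback.snd (α ≫ f) f ≫ f := by
    rw [Category.assoc, pullback.condition]
  have : IsPullback (pullback.lift (pullback.fst _ _ ≫ α) (pullback.snd _ _) w)
      (pullback.fst (α ≫ f) f) (pullback.fst f f) α :=
    .of_right (by rw [pullback.lift_snd]; exact (IsPullback.of_hasPullback (α ≫ f) f).flip)
      (pullback.lift_fst _ _ _) (IsPullback.of_hasPullback f f).flip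
  exact this.flip

theorem lift_actionCat_tgt {T : C} (a : T ⟶ A) (x : T ⟶ X) (w : a ≫ α ≫ f = x ≫ f) :
    ∃ e : T ⟶ (actionCat d).arr, e ≫ (actionCat d).src = a ∧ e ≫ (actionCat d).tgt = d.act a x w :=
  ⟨pullback.lift a x (by simpa using w), pullback.lift_fst _ _ _, d.lift_act a x w⟩

end ActionCat

/-- The internal functor between discrete internal categories induced by a morphism. -/
noncomputable def discreteMap {B Y : C} (b : B ⟶ Y) : discrete B ⟶ discrete Y :=
  homOfObj (E := discrete Y) b rfl

/-! ### Comparison of the two forms of effective descent -/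

section Descent

variable {R K : InternalCat C} [IsIso K.src] {κ : R ⟶ K} (hR : IsKernelPair κ.obj R.src R.tgt)

include hR in
-- Functors into `A` and `B` are determined on objects, so only a morphism of objects has to descend
-- along `p.obj`. Elements identified by `p.obj` are joined by an arrow of `Q`, whose ends have
-- equal images in `B`.
theorem existsUnique_desc_of_hasEffectiveDescent (hκ : IsStableEffectiveEpi κ.obj)
    {A B Q : InternalCat C} {a : A ⟶ K} {b : B ⟶ K} {p : Q ⟶ A} {c : Q ⟶ R}
    (ha : discreteOpfibrations C a) (hb : discreteOpfibrations C b) (sq : IsPullback p c a κ)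
    (w : Q ⟶ B) (hw : w ≫ b = p ≫ a) : ∃! h : A ⟶ B, h ≫ b = a ∧ p ≫ h = w := by
  have := isIso_src_of_discreteOpfibration ha
  have := isIso_src_of_discreteOpfibration hb
  have hc : discreteOpfibrations C c := (discreteOpfibrations C).of_isPullback sq ha
  have hp := hκ.of_isPullback (isPullback_obj sq).flip
  have := hp.effectiveEpi
  have := hp.epi
  obtain ⟨g, hg⟩ := EffectiveEpi.exists_desc p.obj w.obj fun {T} q q' h => by
    have hq : q ≫ c.obj ≫ κ.obj = (q' ≫ c.obj) ≫ κ.obj := by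
      rw [Category.assoc, ← (isPullback_obj sq).w, reassoc_of% h]
    have ht : transportArr hR hc q _ hq ≫ Q.tgt = q' := by
      apply (isPullback_obj sq).hom_ext
      · rw [Category.assoc, ← src_obj_eq_tgt_obj, ← Category.assoc, transportArr_src, h]
      · rw [Category.assoc, transportArr_tgt_map]
    rw [← ht, Category.assoc, ← src_obj_eq_tgt_obj, ← Category.assoc, transportArr_src]
  refine ⟨homOfObj g ?_, ⟨hom_ext_of_isIso_src ?_, hom_ext_of_isIso_src hg⟩, ?_⟩
  · rw [src_eq_tgt_of_isIso_src]
  · rw [← cancel_epi p.obj]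
    have := congrArg Hom.obj hw
    simpa [reassoc_of% hg] using this
  · rintro h' ⟨-, hh⟩
    refine hom_ext_of_isIso_src ?_
    rw [homOfObj_obj, ← cancel_epi p.obj, hg]
    exact congrArg Hom.obj hh

include hR in
theorem exists_isPullback_of_hasEffectiveDescent (hκ : HasEffectiveDescent κ.obj)
    {Q : InternalCat C} {c : Q ⟶ R} (hc : discreteOpfibrations C c) :
    ∃ (A : InternalCat C) (a : A ⟶ K) (p : Q ⟶ A), discreteOpfibrations C a ∧
      IsPullback p c a κ := by
  obtain ⟨B, b, p, sq, hp⟩ := hκ.effective (descentAction hR hc)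
  have hst : Q.src ≫ p = Q.tgt ≫ p := by
    rw [← hp Q.src (Q.tgt ≫ c.obj) (by rw [map_src_comp_eq hR, Category.assoc]), act_src]
  let a : discrete B ⟶ K := homOfObj b (by rw [src_eq_tgt_of_isIso_src])
  let p' : Q ⟶ discrete B := homOfObj p hst
  have ha := discreteOpfibrations_of_isIso_src a
  refine ⟨discrete B, a, p', ha, isPullback_of_obj_arr sq.flip ?_⟩
  -- The square of arrows is obtained by pasting with the square of objects and cancelling the
  -- discrete opfibration `a`.
  have sq₁ := (discreteOpfibrations_iff.1 hc).paste_horiz sq.flip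
  have e : p'.arr ≫ (discrete B).src = Q.src ≫ p := (src_map p').symm
  rw [src_map, ← e] at sq₁
  have hpa : p' ≫ a = c ≫ κ := hom_ext_of_isIso_src sq.flip.w
  exact .of_right sq₁ (congrArg Hom.arr hpa) ha

end Descent

end InternalCat

theorem isEffectiveDescent_of_hasEffectiveDescent {D : Type u} [Category.{v} D] [HasPullbacks D]
    {X Y : D} {f : X ⟶ Y} (hf : HasEffectiveDescent f) : IsEffectiveDescent f := by
  have hR : IsKernelPair (InternalCat.kernelPairFunctor f).obj (InternalCat.kernelPair f).src
    (InternalCat.kernelPair f).tgt := IsPullback.of_hasPullback f f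
  refine (MorphismProperty.over_pullback_isEquivalence_iff _ _).2
    ⟨fun ha hb sq w hw => ?_, fun hc => ?_⟩
  · exact InternalCat.existsUnique_desc_of_hasEffectiveDescent hR hf.stable ha hb sq w hw
  · exact InternalCat.exists_isPullback_of_hasEffectiveDescent hR hf hc

/-- Full faithfulness of base change gives stability, and essential surjectivity, applied to the
category of a descent datum, gives effectiveness. -/
theorem hasEffectiveDescent_of_isEffectiveDescent {D : Type u} [Category.{v} D] [HasPullbacks D]
    [HasBinaryProducts D] {X Y : D} {f : X ⟶ Y} (hf : IsEffectiveDescent f) :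
    HasEffectiveDescent f := by
  obtain ⟨h₁, h₂⟩ := (MorphismProperty.over_pullback_isEquivalence_iff _ _).1 hf
  refine ⟨fun {A B α p b} sq => ?_, fun {A α} d => ?_⟩
  · let b' := InternalCat.discreteMap b
    have sq' := IsPullback.of_hasPullback b' (InternalCat.kernelPairFunctor f)
    have sq₀ : IsPullback (pullback.snd b' (InternalCat.kernelPairFunctor f)).obj
      (pullback.fst b' (InternalCat.kernelPairFunctor f)).obj f b :=
      (InternalCat.isPullback_obj sq').flip
    generalize pullback.fst b' (InternalCat.kernelPairFunctor f) = u at sq' sq₀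
    generalize pullback.snd b' (InternalCat.kernelPairFunctor f) = c at sq' sq₀
    generalize pullback b' (InternalCat.kernelPairFunctor f) = Q at u c sq' sq₀
    let u₀ : Q.obj ⟶ B := u.obj
    have hu : Q.src ≫ u₀ = Q.tgt ≫ u₀ := InternalCat.src_obj_eq_tgt_obj u
    let c₀ : Q.obj ⟶ X := c.obj
    -- `Q.obj` is another pullback of `f` and `b`; `i` and `j` compare it with `A`.
    let i : Q.obj ⟶ A := sq.lift c₀ u₀ sq₀.w
    let j : A ⟶ Q.obj := sq₀.lift α p sq.w
    have hi : i ≫ p = u₀ := sq.lift_snd _ _ _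
    have hi' : i ≫ α = c₀ := sq.lift_fst _ _ _
    have hj : j ≫ u₀ = p := sq₀.lift_snd _ _ _
    have hji : j ≫ i = 𝟙 A := by
      apply sq.hom_ext
      · rw [Category.assoc, hi', Category.id_comp]
        exact sq₀.lift_fst _ _ _
      · rw [Category.assoc, hi, hj, Category.id_comp]
    -- Paired with the map to `Y`, an invariant `e` becomes a functor over the base into the
    -- discrete category on `Y ⨯ W`, so that its factorisation is an instance of `h₁`.
    have key : ∀ {W : D} (e : Q.obj ⟶ W) (he : Q.src ≫ e = Q.tgt ≫ e),
        ∃! g : B ⟶ W, u₀ ≫ g = e := by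
      intro W e he
      have he' : Q.src ≫ prod.lift (u₀ ≫ b) e = Q.tgt ≫ prod.lift (u₀ ≫ b) e := by
        apply Limits.prod.hom_ext <;> simp [reassoc_of% hu, he]
      let w : Q ⟶ InternalCat.discrete (Y ⨯ W) :=
        InternalCat.homOfObj (E := InternalCat.discrete (Y ⨯ W)) (prod.lift (u₀ ≫ b) e) he'
      obtain ⟨g, ⟨hg₁, hg₂⟩, hg₃⟩ := h₁ (InternalCat.discreteOpfibrations_of_isIso_src b')
        (InternalCat.discreteOpfibrations_of_isIso_src (InternalCat.discreteMap prod.fst)) sq' w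
        (InternalCat.hom_ext_of_isIso_src (prod.lift_fst _ _))
      refine ⟨g.obj ≫ (prod.snd : Y ⨯ W ⟶ W), ?_, fun g' hg' => ?_⟩
      · have h : u₀ ≫ g.obj = prod.lift (u₀ ≫ b) e := congrArg InternalCat.Hom.obj hg₂
        exact (Category.assoc _ _ _).symm.trans
          ((congrArg (· ≫ (prod.snd : Y ⨯ W ⟶ W)) h).trans (prod.lift_snd _ _))
      · rw [← hg₃ (InternalCat.discreteMap (prod.lift b g'))
          ⟨InternalCat.hom_ext_of_isIso_src (prod.lift_fst _ _),
            InternalCat.hom_ext_of_isIso_src ?_⟩]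
        · exact (prod.lift_snd _ _).symm
        · change u₀ ≫ prod.lift b g' = prod.lift (u₀ ≫ b) e
          apply Limits.prod.hom_ext <;> simp [hg']
    have : Epi p := ⟨fun {W} g g' h => (key (u₀ ≫ g') (by rw [reassoc_of% hu])).unique
      (by rw [← hi, Category.assoc, Category.assoc, h]) rfl⟩
    refine effectiveEpi_of_exists _ fun {W} e he => ?_
    obtain ⟨g, hg, -⟩ := key (i ≫ e) (by
      rw [← Category.assoc, ← Category.assoc]
      exact he _ _ (by rw [Category.assoc, Category.assoc, hi, hu]))
    exact ⟨g, by rw [← hj, Category.assoc, hg, reassoc_of% hji]⟩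
  · obtain ⟨B, b, p, hb, sq⟩ := h₂ (InternalCat.discreteOpfibrations_actionCatProj d)
    have := InternalCat.isIso_src_of_discreteOpfibration hb
    refine ⟨B.obj, b.obj, p.obj, (InternalCat.isPullback_obj sq).flip, fun a x w => ?_⟩
    obtain ⟨e, he, he'⟩ := InternalCat.lift_actionCat_tgt d a x w
    let p₀ : A ⟶ B.obj := p.obj
    have h : (e ≫ (InternalCat.actionCat d).src) ≫ p.obj =
        (e ≫ (InternalCat.actionCat d).tgt) ≫ p.obj := by
      rw [Category.assoc, Category.assoc, InternalCat.src_obj_eq_tgt_obj p]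
    exact (congrArg (· ≫ p₀) he').symm.trans (h.symm.trans (congrArg (· ≫ p₀) he))

/-! ### Fully faithful functors and their arrow parts -/

namespace InternalCat

variable {C : Type u} [Category.{v} C] [HasPullbacks C]

theorem IsFullyFaithful.exists_lift [HasBinaryProducts C] {H K : InternalCat C} {Φ : H ⟶ K}
    (hff : IsFullyFaithful Φ) {T : C} (x y : T ⟶ H.obj) (k : T ⟶ K.arr)
    (hx : k ≫ K.src = x ≫ Φ.obj) (hy : k ≫ K.tgt = y ≫ Φ.obj) :
    ∃ h : T ⟶ H.arr, h ≫ H.src = x ∧ h ≫ H.tgt = y ∧ h ≫ Φ.arr = k := by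
  have w : k ≫ prod.lift K.src K.tgt = prod.lift x y ≫ prod.map Φ.obj Φ.obj := by
    apply Limits.prod.hom_ext <;> simp [hx, hy]
  have h := IsPullback.lift_snd hff k (prod.lift x y) w
  refine ⟨IsPullback.lift hff k (prod.lift x y) w, ?_, ?_, IsPullback.lift_fst hff _ _ w⟩
  · simpa [prod.lift_fst] using h =≫ prod.fst
  · simpa [prod.lift_snd] using h =≫ prod.snd

theorem IsFullyFaithful.hom_ext [HasBinaryProducts C] {H K : InternalCat C} {Φ : H ⟶ K}
    (hff : IsFullyFaithful Φ) {T : C} {h h' : T ⟶ H.arr} (hs : h ≫ H.src = h' ≫ H.src)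
    (ht : h ≫ H.tgt = h' ≫ H.tgt) (ha : h ≫ Φ.arr = h' ≫ Φ.arr) : h = h' := by
  apply IsPullback.hom_ext hff ha
  apply Limits.prod.hom_ext <;> simp [hs, ht]

/-- The arrow part of a fully faithful functor is a composite of two pullbacks of its object
part. -/
theorem IsFullyFaithful.hasEffectiveDescent_arr [HasBinaryProducts C] {H K : InternalCat C}
    {Φ : H ⟶ K} (hff : IsFullyFaithful Φ) (h₀ : HasEffectiveDescent Φ.obj) :
    HasEffectiveDescent Φ.arr := by
  let q : H.arr ⟶ pullback Φ.obj K.src := pullback.lift H.src Φ.arr (src_map Φ)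
  have hq₁ : q ≫ pullback.fst Φ.obj K.src = H.src := pullback.lift_fst _ _ _
  have hq₂ : q ≫ pullback.snd Φ.obj K.src = Φ.arr := pullback.lift_snd _ _ _
  have w : H.tgt ≫ Φ.obj = q ≫ pullback.snd Φ.obj K.src ≫ K.tgt := by
    rw [reassoc_of% hq₂, tgt_map]
  have hl : ∀ s : PullbackCone Φ.obj (pullback.snd Φ.obj K.src ≫ K.tgt), ∃ l : s.pt ⟶ H.arr,
      l ≫ H.tgt = s.fst ∧ l ≫ q = s.snd := by
    intro s
    obtain ⟨l, hl₁, hl₂, hl₃⟩ := hff.exists_lift (s.snd ≫ pullback.fst Φ.obj K.src) s.fst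
      (s.snd ≫ pullback.snd Φ.obj K.src)
      (by rw [Category.assoc, Category.assoc, pullback.condition])
      (by rw [Category.assoc, ← s.condition])
    refine ⟨l, hl₂, pullback.hom_ext ?_ ?_⟩
    · rw [Category.assoc, hq₁, hl₁]
    · rw [Category.assoc, hq₂, hl₃]
  -- An arrow of `H` is an arrow of `K` with a lift of its source, recorded by `q`, and a lift of
  -- its target, recorded by `H.tgt`.
  have sq : IsPullback H.tgt q Φ.obj (pullback.snd Φ.obj K.src ≫ K.tgt) :=
    ⟨⟨w⟩, ⟨PullbackCone.IsLimit.mk w (fun s => (hl s).choose) (fun s => (hl s).choose_spec.1)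
      (fun s => (hl s).choose_spec.2) fun s m e₁ e₂ => by
        have e := e₂.trans (hl s).choose_spec.2.symm
        refine hff.hom_ext ?_ (e₁.trans (hl s).choose_spec.1.symm) ?_
        · rw [← hq₁, reassoc_of% e]
        · rw [← hq₂, reassoc_of% e]⟩⟩
  rw [← hq₂]
  exact (h₀.of_isPullback sq).comp (h₀.of_isPullback (IsPullback.of_hasPullback _ _))

/-! ### Descending category structure along full covers -/

section FullyFaithfulCover

variable {A : InternalCat C} {B₀ B₁ : C} {s t : B₁ ⟶ B₀} {p₀ : A.obj ⟶ B₀} {p₁ : A.arr ⟶ B₁}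

/-- A morphism of graphs which is full and is a stable effective epimorphism on vertices and
on edges. -/
structure IsFullCover (A : InternalCat C) {B₀ B₁ : C} (s t : B₁ ⟶ B₀) (p₀ : A.obj ⟶ B₀)
    (p₁ : A.arr ⟶ B₁) : Prop where
  src : A.src ≫ p₀ = p₁ ≫ s
  tgt : A.tgt ≫ p₀ = p₁ ≫ t
  stable_obj : IsStableEffectiveEpi p₀
  stable_arr : IsStableEffectiveEpi p₁
  exists_lift : ∀ {T : C} (x y : T ⟶ A.obj) (k : T ⟶ B₁), k ≫ s = x ≫ p₀ → k ≫ t = y ≫ p₀ →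
    ∃ a : T ⟶ A.arr, a ≫ A.src = x ∧ a ≫ A.tgt = y ∧ a ≫ p₁ = k

namespace IsFullCover

variable (h : IsFullCover A s t p₀ p₁)

include h in
-- Only the target needs a local lift; fullness then lifts the edge. Starting at a prescribed source
-- allows strings of edges to be lifted one after another.
theorem exists_lift_of_src {T : C} (x : T ⟶ A.obj) (k : T ⟶ B₁) (hx : k ≫ s = x ≫ p₀) :
    ∃ (S : C) (c : S ⟶ T) (a : S ⟶ A.arr), IsStableEffectiveEpi c ∧ a ≫ A.src = c ≫ x ∧
      a ≫ p₁ = c ≫ k := by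
  obtain ⟨S, c, y, hc, hy⟩ := h.stable_obj.exists_lift (k ≫ t)
  obtain ⟨a, ha₁, -, ha₃⟩ := h.exists_lift (c ≫ x) y (c ≫ k) (by simp [hx]) (by simp [hy])
  exact ⟨S, c, a, hc, ha₁, ha₃⟩

include h in
theorem exists_lift_pair {T : C} (k l : T ⟶ B₁) (w : k ≫ t = l ≫ s) :
    ∃ (S : C) (c : S ⟶ T) (a b : S ⟶ A.arr), IsStableEffectiveEpi c ∧ a ≫ A.tgt = b ≫ A.src ∧
      a ≫ p₁ = c ≫ k ∧ b ≫ p₁ = c ≫ l := by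
  obtain ⟨S₁, c₁, a, hc₁, ha⟩ := h.stable_arr.exists_lift k
  obtain ⟨S₂, c₂, b, hc₂, hb₁, hb₂⟩ := h.exists_lift_of_src (a ≫ A.tgt) (c₁ ≫ l)
    (by rw [Category.assoc, ← w, Category.assoc, h.tgt, reassoc_of% ha])
  exact ⟨S₂, c₂ ≫ c₁, c₂ ≫ a, b, hc₂.comp hc₁, by simp [hb₁], by simp [ha], by simp [hb₂]⟩

include h in
theorem exists_lift_triple {T : C} (k l m : T ⟶ B₁) (w : k ≫ t = l ≫ s) (w' : l ≫ t = m ≫ s) :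
    ∃ (S : C) (c : S ⟶ T) (a b e : S ⟶ A.arr), IsStableEffectiveEpi c ∧
      a ≫ A.tgt = b ≫ A.src ∧ b ≫ A.tgt = e ≫ A.src ∧
      a ≫ p₁ = c ≫ k ∧ b ≫ p₁ = c ≫ l ∧ e ≫ p₁ = c ≫ m := by
  obtain ⟨S₁, c₁, a, b, hc₁, hab, ha, hb⟩ := h.exists_lift_pair k l w
  obtain ⟨S₂, c₂, e, hc₂, he₁, he₂⟩ := h.exists_lift_of_src (b ≫ A.tgt) (c₁ ≫ m)
    (by rw [Category.assoc, ← w', Category.assoc, h.tgt, reassoc_of% hb])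
  exact ⟨S₂, c₂ ≫ c₁, c₂ ≫ a, c₂ ≫ b, e, hc₂.comp hc₁, by simp [hab], by simp [he₁],
    by simp [ha], by simp [hb], by simp [he₂]⟩

include h in
theorem pair_w {T : C} {a b : T ⟶ A.arr} (w : a ≫ A.tgt = b ≫ A.src) :
    (a ≫ p₁) ≫ t = (b ≫ p₁) ≫ s := by
  rw [Category.assoc, Category.assoc, ← h.src, ← h.tgt, reassoc_of% w]

/-- A composition on arrows is descended along a full cover as soon as it is compatible with it. -/
theorem exists_comp (hcompat : ∀ {T : C} (a b a' b' : T ⟶ A.arr) (w : a ≫ A.tgt = b ≫ A.src)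
      (w' : a' ≫ A.tgt = b' ≫ A.src), a ≫ p₁ = a' ≫ p₁ → b ≫ p₁ = b' ≫ p₁ →
        A.mul a b w ≫ p₁ = A.mul a' b' w' ≫ p₁) :
    ∃ m : pullback t s ⟶ B₁, ∀ {T : C} (a b : T ⟶ A.arr) (w : a ≫ A.tgt = b ≫ A.src),
      pullback.lift (a ≫ p₁) (b ≫ p₁) (h.pair_w w) ≫ m = A.mul a b w ≫ p₁ := by
  let p₂ : pullback A.tgt A.src ⟶ pullback t s := pullback.lift (pullback.fst _ _ ≫ p₁)
    (pullback.snd _ _ ≫ p₁) (h.pair_w pullback.condition)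
  have hp₂ : ∀ {T : C} (a b : T ⟶ A.arr) (w : a ≫ A.tgt = b ≫ A.src),
      pullback.lift a b w ≫ p₂ = pullback.lift (a ≫ p₁) (b ≫ p₁) (h.pair_w w) := by
    intro T a b w
    apply pullback.hom_ext <;> simp [p₂, pullback.lift_fst, pullback.lift_snd,
      pullback.lift_fst_assoc, pullback.lift_snd_assoc]
  obtain ⟨S, c, a, b, hc, hab, ha, hb⟩ := h.exists_lift_pair (pullback.fst t s) (pullback.snd t s)
    pullback.condition
  -- The universal composable pair of edges lifts locally, which gives `p₂` a local section.
  have : EffectiveEpi p₂ := hc.effectiveEpi_of_lift p₂ (pullback.lift a b hab) (by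
    rw [hp₂]
    apply pullback.hom_ext <;> simp [pullback.lift_fst, pullback.lift_snd, ha, hb])
  obtain ⟨m, hm⟩ := EffectiveEpi.exists_desc p₂ (A.comp ≫ p₁) fun {T} a a' ha => by
    rw [comp_eq_mul, ← Category.assoc, ← Category.assoc, comp_mul, comp_mul]
    apply hcompat
    · simpa [p₂, pullback.lift_fst] using ha =≫ pullback.fst t s
    · simpa [p₂, pullback.lift_snd] using ha =≫ pullback.snd t s
  exact ⟨m, fun a b w => by rw [← hp₂, Category.assoc, hm, mul, Category.assoc]⟩

/-- The internal category structure descended along a full cover. -/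
noncomputable def descCat (i : B₀ ⟶ B₁) (hi : p₀ ≫ i = A.idt ≫ p₁) (m : pullback t s ⟶ B₁)
    (hm : ∀ {T : C} (a b : T ⟶ A.arr) (w : a ≫ A.tgt = b ≫ A.src),
      pullback.lift (a ≫ p₁) (b ≫ p₁) (h.pair_w w) ≫ m = A.mul a b w ≫ p₁) : InternalCat C :=
  have := h.stable_obj.epi
  have := h.stable_arr.epi
  have hcongr : ∀ {T : C} {k l k' l' : T ⟶ B₁} (_ : k = k') (_ : l = l') (w : k ≫ t = l ≫ s)
    (w' : k' ≫ t = l' ≫ s), pullback.lift k l w ≫ m = pullback.lift k' l' w' ≫ m := by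
    rintro T k l _ _ rfl rfl w w'
    rfl
  have hcomp : ∀ {S T : C} (c : S ⟶ T) (k l : T ⟶ B₁) (w : k ≫ t = l ≫ s),
    c ≫ pullback.lift k l w ≫ m = pullback.lift (c ≫ k) (c ≫ l) (by simp [w]) ≫ m := by
    intro S T c k l w
    rw [← Category.assoc]
    congr 1
    apply pullback.hom_ext <;> simp [pullback.lift_fst, pullback.lift_snd]
  have hdiag : ∀ {T : C} (k : T ⟶ pullback t s), k ≫ m =
      pullback.lift (k ≫ pullback.fst t s) (k ≫ pullback.snd t s)
        (by simp [pullback.condition]) ≫ m := by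
    intro T k
    congr 1
    apply pullback.hom_ext <;> simp [pullback.lift_fst, pullback.lift_snd]
  -- This law, like the other laws on composites, is verified on local lifts, where it becomes a law
  -- of `A`.
  have hs : m ≫ s = pullback.fst t s ≫ s := by
    obtain ⟨S, c, a, b, hc, hab, ha, hb⟩ := h.exists_lift_pair _ _
      (pullback.condition (f := t) (g := s))
    have := hc.epi
    rw [← cancel_epi c, ← Category.assoc, hdiag, hcongr ha.symm hb.symm _ (h.pair_w hab),
      hm a b hab,
      Category.assoc, ← h.src, ← Category.assoc, mul_src, Category.assoc, h.src, reassoc_of% ha]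
  have ht : m ≫ t = pullback.snd t s ≫ t := by
    obtain ⟨S, c, a, b, hc, hab, ha, hb⟩ := h.exists_lift_pair _ _
      (pullback.condition (f := t) (g := s))
    have := hc.epi
    rw [← cancel_epi c, ← Category.assoc, hdiag, hcongr ha.symm hb.symm _ (h.pair_w hab),
      hm a b hab,
      Category.assoc, ← h.tgt, ← Category.assoc, mul_tgt, Category.assoc, h.tgt, reassoc_of% hb]
  { obj := B₀
    arr := B₁
    src := s
    tgt := t
    idt := i
    comp := m
    idt_src := by rw [← cancel_epi p₀, reassoc_of% hi, ← h.src]; simp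
    idt_tgt := by rw [← cancel_epi p₀, reassoc_of% hi, ← h.tgt]; simp
    comp_src := hs
    comp_tgt := ht
    idt_comp := by
      rw [← cancel_epi p₁, hcomp]
      have e := hm (A.src ≫ A.idt) (𝟙 _) (by simp)
      rw [show A.mul (A.src ≫ A.idt) (𝟙 _) (by simp) = 𝟙 _ from A.idt_comp] at e
      refine (hcongr ?_ ?_ _ _).trans (e.trans ?_)
      · rw [← reassoc_of% h.src, hi, Category.assoc]
      · simp
      · simp
    comp_idt := by
      rw [← cancel_epi p₁, hcomp]
      have e := hm (𝟙 _) (A.tgt ≫ A.idt) (by simp)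
      rw [show A.mul (𝟙 _) (A.tgt ≫ A.idt) (by simp) = 𝟙 _ from A.comp_idt] at e
      refine (hcongr ?_ ?_ _ _).trans (e.trans ?_)
      · simp
      · rw [← reassoc_of% h.tgt, hi, Category.assoc]
      · simp
    assoc := fun k l n w w' => by
      obtain ⟨S, c, a, b, e, hc, hab, hbe, ha, hb, he⟩ := h.exists_lift_triple k l n w w'
      have := hc.epi
      rw [← cancel_epi c]
      have h₁ : c ≫ pullback.lift k l w ≫ m = A.mul a b hab ≫ p₁ := by
        rw [hcomp, ← hm]
        exact hcongr ha.symm hb.symm _ _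
      have h₂ : c ≫ pullback.lift l n w' ≫ m = A.mul b e hbe ≫ p₁ := by
        rw [hcomp, ← hm]
        exact hcongr hb.symm he.symm _ _
      have w₁ : A.mul a b hab ≫ A.tgt = e ≫ A.src := by rw [mul_tgt, hbe]
      have w₂ : a ≫ A.tgt = A.mul b e hbe ≫ A.src := by rw [mul_src, hab]
      refine (hcomp _ _ _ _).trans <| (hcongr h₁ he.symm _ (h.pair_w w₁)).trans <|
        Eq.trans ?_ <| (hcongr ha.symm h₂ _ (h.pair_w w₂)).symm.trans (hcomp _ _ _ _).symm
      rw [hm _ e w₁, hm a _ w₂, mul_mul _ _ _ _ hab hbe] }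

/-- The functor to the descended internal category. -/
noncomputable def descCatProj (i : B₀ ⟶ B₁) (hi : p₀ ≫ i = A.idt ≫ p₁) (m : pullback t s ⟶ B₁)
    (hm : ∀ {T : C} (a b : T ⟶ A.arr) (w : a ≫ A.tgt = b ≫ A.src),
      pullback.lift (a ≫ p₁) (b ≫ p₁) (h.pair_w w) ≫ m = A.mul a b w ≫ p₁) :
    A ⟶ h.descCat i hi m hm :=
  homMk (K := h.descCat i hi m hm) p₀ p₁ h.src h.tgt hi.symm fun a b w => (hm a b w).symm

end IsFullCover

variable {B Z : InternalCat C} {p : A ⟶ B} (h : IsFullCover A B.src B.tgt p.obj p.arr)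

/-- Functors descend along a full cover as soon as they descend on objects and on arrows. -/
def IsFullCover.descHom {e : A ⟶ Z} (g₀ : B.obj ⟶ Z.obj)
    (g₁ : B.arr ⟶ Z.arr) (h₀ : p.obj ≫ g₀ = e.obj) (h₁ : p.arr ≫ g₁ = e.arr) : B ⟶ Z :=
  have := h.stable_obj.epi
  have := h.stable_arr.epi
  homMk g₀ g₁
    (by rw [← cancel_epi p.arr, ← Category.assoc, ← src_map, Category.assoc, h₀, reassoc_of% h₁,
      src_map])
    (by rw [← cancel_epi p.arr, ← Category.assoc, ← tgt_map, Category.assoc, h₀, reassoc_of% h₁,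
      tgt_map])
    (by rw [← cancel_epi p.obj, ← Category.assoc, ← idt_map, Category.assoc, h₁, reassoc_of% h₀,
      idt_map])
    fun k l w => by
      obtain ⟨S, c, a, b, hc, hab, ha, hb⟩ := h.exists_lift_pair k l w
      have := hc.epi
      have hk : a ≫ e.arr = c ≫ k ≫ g₁ := by rw [← h₁, reassoc_of% ha]
      have hl : b ≫ e.arr = c ≫ l ≫ g₁ := by rw [← h₁, reassoc_of% hb]
      rw [← cancel_epi c, ← Category.assoc, comp_mul, comp_mul, mul_congr _ ha.symm hb.symm,
        ← mul_map p a b hab, Category.assoc]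
      exact (congrArg (_ ≫ ·) h₁).trans ((mul_map e a b hab).trans (mul_congr _ hk hl _))

end FullyFaithfulCover

end InternalCat

/-! ### Effective descent for fully faithful functors -/

namespace InternalCat

variable {C : Type u} [Category.{v} C] [HasPullbacks C]

section

variable {H K A : InternalCat C} {Φ : H ⟶ K} {α : A ⟶ H} (d : DescentAction Φ α)

/-- The descent datum on objects induced by a descent datum for an internal functor. -/
noncomputable def objAction : DescentAction Φ.obj α.obj := d.map (objFunctor C)

/-- The descent datum on arrows induced by a descent datum for an internal functor. -/
noncomputable def arrAction : DescentAction Φ.arr α.arr := d.map (arrFunctor C)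

theorem comp_obj_w {T : InternalCat C} {a : T ⟶ A} {x : T ⟶ H} (w : a ≫ α ≫ Φ = x ≫ Φ) {S : C}
    (k : S ⟶ T.obj) : (k ≫ a.obj) ≫ α.obj ≫ Φ.obj = (k ≫ x.obj) ≫ Φ.obj := by
  simpa using k ≫= congrArg Hom.obj w

theorem comp_arr_w {T : InternalCat C} {a : T ⟶ A} {x : T ⟶ H} (w : a ≫ α ≫ Φ = x ≫ Φ) {S : C}
    (k : S ⟶ T.arr) : (k ≫ a.arr) ≫ α.arr ≫ Φ.arr = (k ≫ x.arr) ≫ Φ.arr := by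
  simpa using k ≫= congrArg Hom.arr w

theorem objAction_comp {T : InternalCat C} (a : T ⟶ A) (x : T ⟶ H) (w : a ≫ α ≫ Φ = x ≫ Φ)
    {S : C} (k : S ⟶ T.obj) :
    (objAction d).act (k ≫ a.obj) (k ≫ x.obj) (comp_obj_w w k) = k ≫ (d.act a x w).obj :=
  d.mapAct_map (objFunctor C) k a x w

theorem arrAction_comp {T : InternalCat C} (a : T ⟶ A) (x : T ⟶ H) (w : a ≫ α ≫ Φ = x ≫ Φ)
    {S : C} (k : S ⟶ T.arr) :
    (arrAction d).act (k ≫ a.arr) (k ≫ x.arr) (comp_arr_w w k) = k ≫ (d.act a x w).arr :=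
  d.mapAct_map (arrFunctor C) k a x w

theorem exists_lift_obj {T : C} (a : T ⟶ A.obj) (x : T ⟶ H.obj)
    (w : a ≫ α.obj ≫ Φ.obj = x ≫ Φ.obj) : ∃ k : T ⟶ (pullback (α ≫ Φ) Φ).obj,
      k ≫ (pullback.fst (α ≫ Φ) Φ).obj = a ∧ k ≫ (pullback.snd (α ≫ Φ) Φ).obj = x :=
  DescentAction.exists_lift_map (objFunctor C) a x w

theorem exists_lift_arr {T : C} (a : T ⟶ A.arr) (x : T ⟶ H.arr)
    (w : a ≫ α.arr ≫ Φ.arr = x ≫ Φ.arr) : ∃ k : T ⟶ (pullback (α ≫ Φ) Φ).arr,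
      k ≫ (pullback.fst (α ≫ Φ) Φ).arr = a ∧ k ≫ (pullback.snd (α ≫ Φ) Φ).arr = x :=
  DescentAction.exists_lift_map (arrFunctor C) a x w

theorem pullback_w : pullback.fst (α ≫ Φ) Φ ≫ α ≫ Φ = pullback.snd (α ≫ Φ) Φ ≫ Φ := by
  simpa using pullback.condition (f := α ≫ Φ) (g := Φ)

/-- On the universal pair the action is an internal functor, which commutes with sources; the
general case follows by precomposition. -/
theorem arrAction_src {T : C} (a : T ⟶ A.arr) (x : T ⟶ H.arr)
    (w : a ≫ α.arr ≫ Φ.arr = x ≫ Φ.arr) :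
    (arrAction d).act a x w ≫ A.src = (objAction d).act (a ≫ A.src) (x ≫ H.src)
      (by rw [Category.assoc, reassoc_of% src_map, src_map, reassoc_of% w, Category.assoc,
        src_map]) := by
  obtain ⟨k, rfl, rfl⟩ := exists_lift_arr a x w
  rw [arrAction_comp d _ _ pullback_w, Category.assoc, ← src_map, ← Category.assoc,
    ← objAction_comp]
  exact DescentAction.act_congr _ (by simp [src_map]) (by simp [src_map]) _

theorem arrAction_tgt {T : C} (a : T ⟶ A.arr) (x : T ⟶ H.arr)
    (w : a ≫ α.arr ≫ Φ.arr = x ≫ Φ.arr) :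
    (arrAction d).act a x w ≫ A.tgt = (objAction d).act (a ≫ A.tgt) (x ≫ H.tgt)
      (by rw [Category.assoc, reassoc_of% tgt_map, tgt_map, reassoc_of% w, Category.assoc,
        tgt_map]) := by
  obtain ⟨k, rfl, rfl⟩ := exists_lift_arr a x w
  rw [arrAction_comp d _ _ pullback_w, Category.assoc, ← tgt_map, ← Category.assoc,
    ← objAction_comp]
  exact DescentAction.act_congr _ (by simp [tgt_map]) (by simp [tgt_map]) _

theorem objAction_idt {T : C} (a : T ⟶ A.obj) (x : T ⟶ H.obj)
    (w : a ≫ α.obj ≫ Φ.obj = x ≫ Φ.obj) :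
    (objAction d).act a x w ≫ A.idt = (arrAction d).act (a ≫ A.idt) (x ≫ H.idt)
      (by rw [Category.assoc, reassoc_of% idt_map, idt_map, reassoc_of% w, Category.assoc,
        idt_map]) := by
  obtain ⟨k, rfl, rfl⟩ := exists_lift_obj a x w
  rw [objAction_comp d _ _ pullback_w, Category.assoc, ← idt_map, ← Category.assoc,
    ← arrAction_comp]
  exact DescentAction.act_congr _ (by simp [idt_map]) (by simp [idt_map]) _

theorem arrAction_mul {T : C} (a b : T ⟶ A.arr) (x y : T ⟶ H.arr)
    (wa : a ≫ α.arr ≫ Φ.arr = x ≫ Φ.arr) (wb : b ≫ α.arr ≫ Φ.arr = y ≫ Φ.arr)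
    (hab : a ≫ A.tgt = b ≫ A.src) (hxy : x ≫ H.tgt = y ≫ H.src)
    (hact : (arrAction d).act a x wa ≫ A.tgt = (arrAction d).act b y wb ≫ A.src)
    (w : A.mul a b hab ≫ α.arr ≫ Φ.arr = H.mul x y hxy ≫ Φ.arr) :
    A.mul ((arrAction d).act a x wa) ((arrAction d).act b y wb) hact =
      (arrAction d).act (A.mul a b hab) (H.mul x y hxy) w := by
  obtain ⟨k, rfl, rfl⟩ := exists_lift_arr a x wa
  obtain ⟨l, rfl, rfl⟩ := exists_lift_arr b y wb
  -- Composability in both components makes `k` and `l` composable in the pullback category, where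
  -- functoriality of the action applies to their composite.
  have hkl : k ≫ (pullback (α ≫ Φ) Φ).tgt = l ≫ (pullback (α ≫ Φ) Φ).src := by
    apply (isPullback_obj (IsPullback.of_hasPullback (α ≫ Φ) Φ)).hom_ext
    · simpa [src_map, tgt_map] using hab
    · simpa [src_map, tgt_map] using hxy
  rw [mul_congr _ (arrAction_comp d _ _ pullback_w _) (arrAction_comp d _ _ pullback_w _),
    ← mul_map _ k l hkl,
    ← arrAction_comp]
  exact DescentAction.act_congr _ (mul_map _ _ _ _) (mul_map _ _ _ _) _

end

/-- Fullness is inherited from `Φ`: the image of the edge in `K` lifts to `H` between the prescribed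
ends, and together with the edge it defines an arrow of `A`. -/
theorem IsFullyFaithful.isFullCover [HasBinaryProducts C] {H K A : InternalCat C} {Φ : H ⟶ K}
    (hff : IsFullyFaithful Φ) (h₀ : IsStableEffectiveEpi Φ.obj) (h₁ : IsStableEffectiveEpi Φ.arr)
    {α : A ⟶ H} {B₀ B₁ : C} {s t : B₁ ⟶ B₀} {p₀ : A.obj ⟶ B₀} {p₁ : A.arr ⟶ B₁} {b₀ : B₀ ⟶ K.obj}
    {b₁ : B₁ ⟶ K.arr} (sq₀ : IsPullback α.obj p₀ Φ.obj b₀) (sq₁ : IsPullback α.arr p₁ Φ.arr b₁)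
    (src : A.src ≫ p₀ = p₁ ≫ s) (tgt : A.tgt ≫ p₀ = p₁ ≫ t) (hs : s ≫ b₀ = b₁ ≫ K.src)
    (ht : t ≫ b₀ = b₁ ≫ K.tgt) : IsFullCover A s t p₀ p₁ where
  src := src
  tgt := tgt
  stable_obj := h₀.of_isPullback sq₀
  stable_arr := h₁.of_isPullback sq₁
  exists_lift x y k hx hy := by
    obtain ⟨h, hh₁, hh₂, hh₃⟩ := hff.exists_lift (x ≫ α.obj) (y ≫ α.obj) (k ≫ b₁)
      (by rw [Category.assoc, ← hs, reassoc_of% hx, Category.assoc, sq₀.w])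
      (by rw [Category.assoc, ← ht, reassoc_of% hy, Category.assoc, sq₀.w])
    refine ⟨sq₁.lift h k hh₃, sq₀.hom_ext ?_ ?_, sq₀.hom_ext ?_ ?_, sq₁.lift_snd _ _ _⟩
    · rw [Category.assoc, src_map, ← hh₁, sq₁.lift_fst_assoc]
    · rw [Category.assoc, src, sq₁.lift_snd_assoc, hx]
    · rw [Category.assoc, tgt_map, ← hh₂, sq₁.lift_fst_assoc]
    · rw [Category.assoc, tgt, sq₁.lift_snd_assoc, hy]

/-- A full cover is an effective epimorphism of internal categories. -/
theorem IsFullCover.effectiveEpi {A B : InternalCat C} {p : A ⟶ B}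
    (h : IsFullCover A B.src B.tgt p.obj p.arr) : EffectiveEpi p := by
  have := h.stable_obj.epi
  have := h.stable_arr.epi
  have := h.stable_obj.effectiveEpi
  have := h.stable_arr.effectiveEpi
  have : Epi p := ⟨fun u v huv => by
    ext
    · rw [← cancel_epi p.obj]
      exact congrArg Hom.obj huv
    · rw [← cancel_epi p.arr]
      exact congrArg Hom.arr huv⟩
  have sq := IsPullback.of_hasPullback p p
  refine effectiveEpi_of_exists p fun {Z} e he => ?_
  have hk := he (pullback.fst p p) (pullback.snd p p) pullback.condition
  obtain ⟨g₀, hg₀⟩ := EffectiveEpi.exists_desc p.obj e.obj fun a a' w => by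
    rw [← (isPullback_obj sq).lift_fst a a' w, Category.assoc, ← comp_obj, hk, comp_obj,
      (isPullback_obj sq).lift_snd_assoc]
  obtain ⟨g₁, hg₁⟩ := EffectiveEpi.exists_desc p.arr e.arr fun a a' w => by
    rw [← (isPullback_arr sq).lift_fst a a' w, Category.assoc, ← comp_arr, hk, comp_arr,
      (isPullback_arr sq).lift_snd_assoc]
  refine ⟨h.descHom g₀ g₁ hg₀ hg₁, ?_⟩
  ext
  · exact hg₀
  · exact hg₁

theorem IsFullyFaithful.isStableEffectiveEpi [HasBinaryProducts C] {H K : InternalCat C}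
    {Φ : H ⟶ K} (hff : IsFullyFaithful Φ) (h₀ : HasEffectiveDescent Φ.obj) :
    IsStableEffectiveEpi Φ := fun _ _ _ _ _ sq =>
  (hff.isFullCover h₀.stable (hff.hasEffectiveDescent_arr h₀).stable (isPullback_obj sq)
    (isPullback_arr sq) (src_map _) (tgt_map _) (src_map _) (tgt_map _)).effectiveEpi

/-- The data on objects and on arrows are effective separately; compatibility of the action with the
category structure of `A` makes that structure descend. -/
theorem IsFullyFaithful.hasEffectiveDescent [HasBinaryProducts C] {H K : InternalCat C}
    {Φ : H ⟶ K} (hff : IsFullyFaithful Φ) (h₀ : HasEffectiveDescent Φ.obj) :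
    HasEffectiveDescent Φ where
  stable := hff.isStableEffectiveEpi h₀
  effective {A α} d := by
    have h₁ := hff.hasEffectiveDescent_arr h₀
    obtain ⟨B₀, b₀, p₀, sq₀, hp₀⟩ := h₀.effective (objAction d)
    obtain ⟨B₁, b₁, p₁, sq₁, hp₁⟩ := h₁.effective (arrAction d)
    have hs₀ := h₀.stable.of_isPullback sq₀
    have hs₁ := h₁.stable.of_isPullback sq₁
    have := hs₀.epi
    have := hs₁.epi
    have := hs₀.effectiveEpi
    have := hs₁.effectiveEpi
    -- Elements identified by `p₁` are transports of each other, and taking sources turns a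
    -- transport of arrows into a transport of objects, which `p₀` does not see.
    obtain ⟨s, hs⟩ := EffectiveEpi.exists_desc p₁ (A.src ≫ p₀) fun a a' h => by
      rw [(arrAction d).eq_act sq₁ hp₁ h, ← Category.assoc, ← Category.assoc, arrAction_src, hp₀]
    obtain ⟨t, ht⟩ := EffectiveEpi.exists_desc p₁ (A.tgt ≫ p₀) fun a a' h => by
      rw [(arrAction d).eq_act sq₁ hp₁ h, ← Category.assoc, ← Category.assoc, arrAction_tgt, hp₀]
    obtain ⟨i, hi⟩ := EffectiveEpi.exists_desc p₀ (A.idt ≫ p₁) fun a a' h => by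
      rw [(objAction d).eq_act sq₀ hp₀ h, ← Category.assoc, ← Category.assoc, objAction_idt, hp₁]
    have cover : IsFullCover A s t p₀ p₁ :=
      hff.isFullCover h₀.stable h₁.stable sq₀ sq₁ hs.symm ht.symm
        (by rw [← cancel_epi p₁, reassoc_of% hs, ← sq₀.w, reassoc_of% src_map, src_map,
          reassoc_of% sq₁.w])
        (by rw [← cancel_epi p₁, reassoc_of% ht, ← sq₀.w, reassoc_of% tgt_map, tgt_map,
          reassoc_of% sq₁.w])
    -- Replacing `a'` and `b'` by transports of `a` and `b`, the composite becomes a transport of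
    -- the composite of `a` and `b`, which `p₁` does not see.
    obtain ⟨m, hm⟩ := cover.exists_comp fun a b a' b' w w' ha hb => by
      have ea := (arrAction d).eq_act sq₁ hp₁ ha
      have eb := (arrAction d).eq_act sq₁ hp₁ hb
      have wx : (a' ≫ α.arr) ≫ H.tgt = (b' ≫ α.arr) ≫ H.src := by
        rw [Category.assoc, Category.assoc, ← src_map, ← tgt_map, reassoc_of% w']
      have wm : A.mul a b w ≫ α.arr ≫ Φ.arr = H.mul (a' ≫ α.arr) (b' ≫ α.arr) wx ≫ Φ.arr := by
        rw [← Category.assoc, mul_map, mul_map, mul_map]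
        exact mul_congr _ (by rw [Category.assoc, Category.assoc, sq₁.w, reassoc_of% ha])
          (by rw [Category.assoc, Category.assoc, sq₁.w, reassoc_of% hb]) _
      rw [mul_congr _ ea eb w', arrAction_mul d a b _ _ _ _ w wx _ wm, hp₁]
    let p := cover.descCatProj i hi m hm
    let B := cover.descCat i hi m hm
    let b : B ⟶ K := IsFullCover.descHom (p := p) cover (e := α ≫ Φ) b₀ b₁ sq₀.w.symm sq₁.w.symm
    refine ⟨B, b, p, isPullback_of_obj_arr sq₀ sq₁, fun {T} a x w => ?_⟩
    -- The identities of `T.obj` and `T.arr` are the universal elements, so invariance of `p₀` and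
    -- `p₁` there gives the equality of functors.
    have e₀ := objAction_comp d a x w (𝟙 _)
    have e₁ := arrAction_comp d a x w (𝟙 _)
    have hq₀ := hp₀ _ _ (comp_obj_w w (𝟙 _))
    have hq₁ := hp₁ _ _ (comp_arr_w w (𝟙 _))
    rw [e₀, Category.id_comp, Category.id_comp] at hq₀
    rw [e₁, Category.id_comp, Category.id_comp] at hq₁
    ext
    · exact hq₀
    · exact hq₁

end InternalCat

theorem mainTheorem6 {C : Type u} [Category.{v} C] [HasFiniteLimits C] {H K : InternalCat C}
    (Φ : H ⟶ K) (hff : InternalCat.IsFullyFaithful Φ) (h₀ : IsEffectiveDescent Φ.obj) :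
    IsEffectiveDescent Φ ∧ IsEffectiveDescent Φ.arr := by
  have h := hasEffectiveDescent_of_isEffectiveDescent h₀
  exact ⟨isEffectiveDescent_of_hasEffectiveDescent (hff.hasEffectiveDescent h),
    isEffectiveDescent_of_hasEffectiveDescent (hff.hasEffectiveDescent_arr h)⟩
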